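/- Let $d\ge 1$ and let $\mathcal S=\mathcal S(\mathbb R^d)$ be the space of real Schwartz functions, $\mathcal S'$ its dual with the weak topology and Borel $\sigma$-algebra $\mathcal B(\mathcal S')$. A *(tempered) random field* is a family $(Y(f))_{f\in\mathcal S}$ of real random variables on a probability space $(\Omega,P)$ that is almost surely linear in $f$ and such that $f_n\to f$ in $\mathcal S$ implies $Y(f_n)\to Y(f)$ in law; its law is the probability measure $P^Y$ on $(\mathcal S',\mathcal B(\mathcal S'))$ with $\int e^{i\omega(f)}\,dP^Y(\omega)=\mathbb E_P[e^{iY(f)}]$ for all $f\in\mathcal S$. It *has paths in* $E\subseteq\mathcal S'$ if $\sup\{P^Y(B): B\in\mathcal B(\mathcal S'),\ B\subseteq E\}=1$. Put $g_\epsilon(x)=(1+|x|^2)^{-(d+\epsilon)/2}$; the space $L^1(\mathbb R^d,g_\epsilon dx)$ is regarded as a subset of $\mathcal S'$ via $u\mapsto\big(f\mapsto\int uf\,dx\big)$. Let $z\ge 0$, and let $r$ be a probability measure on $\mathbb R$ with $r(\{0\})=0$ and $\operatorname{supp} r\subseteq[-c,c]$ for some $c>0$. The Poisson noise $F$ with activity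 $z$ and Lévy measure $r$ is the coordinate process of a probability measure $P^F$ on $\mathcal S'$ with $$\int_{\mathcal S'} e^{i\omega(f)}\,dP^F(\omega)=\exp\Big(\int_{\mathbb R^d}\psi(f(x))\,dx\Big),\qquad \psi(t)=z\int_{\mathbb R}(e^{ist}-1)\,dr(s),\qquad f\in\mathcal S.$$ Let $G\in L^1(\mathbb R^d,dx)$, and let $X=G*F$ be the convoluted Poisson noise (CPN), that is, the $\mathcal S'$-valued random variable with $\langle X,f\rangle=\langle F,\check G*f\rangle$ a.s. for each $f\in\mathcal S$, where $\check G(x)=G(-x)$ and $\langle F,h\rangle$ for $h\in L^1(\mathbb R^d,dx)$ is the limit in probability of $\langle F,u_n\rangle$ for $u_n\in\mathcal S$ with $u_n\to h$ in $L^1(\mathbb R^d,dx)$. Let $P^X$ be its law on $\mathcal S'$; from now on $X$ denotes the coordinate process under $P^X$. **Theorem.** Let $v:\mathbb R\to\mathbb R$ be measurable with $|v(t)|\le a+b|t|$ for all $t$, for some $a,b\ge 0$. Let $\Lambda\subseteq\mathbb R^d$ be compact and $\beta\ge 0$. Then: (i) For every $\epsilon>0$, the field $X$ has paths in $L^1(\mathbb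 R^d,g_\epsilon dx)$, so that $P^X$-a.s. $X$ is a function $x\mapsto X(x)$ and $v(X)(x)=v(X(x))$ is defined for almost every $x$ (on the exceptional null set of paths that are not functions, put $v(X)=0$). $P^X$-a.s. the function $v(X)$ belongs to $L^1(\mathbb R^d,g_\epsilon dx)$, and $f\mapsto\langle v(X),f\rangle=\int v(X(x))f(x)\,dx$ is a random field with paths in $L^1(\mathbb R^d,g_\epsilon dx)$. (ii) $V_\Lambda=\langle v(X),1_\Lambda\rangle\in\bigcap_{1\le p<\infty}L^p(\mathcal S',P^X)$. (iii) $e^{-\beta V_\Lambda}\in\bigcap_{1\le p<\infty}L^p(\mathcal S',P^X)$. (iv) $\Xi_\Lambda=\mathbb E_{P^X}[e^{-\beta V_\Lambda}]$ satisfies $0<\Xi_\Lambda<\infty$, and $\Xi_\Lambda^{-1}e^{-\beta V_\Lambda}P^X$ is a probability measure on $(\mathcal S',\mathcal B(\mathcal S'))$. -/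

import Mathlib

open MeasureTheory Filter Topology
open scoped SchwartzMap ENNReal

noncomputable section

namespace CPN

/-- The Euclidean space-time `ℝ^d`. -/
abbrev Space (d : ℕ) : Type := EuclideanSpace ℝ (Fin d)

/-- The real tempered distributions `𝓢'(ℝ^d)`, with the weak topology. -/
abbrev Tempered (d : ℕ) : Type := WeakDual ℝ 𝓢(Space d, ℝ)

/-- The Borel σ-algebra of the weak topology on `𝓢'`. -/
instance instMeasurableSpaceTempered (d : ℕ) : MeasurableSpace (Tempered d) :=
  borel (Tempered d)

instance instBorelSpaceTempered (d : ℕ) : BorelSpace (Tempered d) := ⟨rfl⟩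

/-! ### Random fields -/

/-- A tempered random field over `ℝ^d` on the probability space `(Ω, P)`: a family of real random
variables (up to modification on null sets), almost surely linear in the test function, and
continuous in law. -/
structure IsRandomField {d : ℕ} {Ω : Type*} [MeasurableSpace Ω] (P : Measure Ω)
    [IsProbabilityMeasure P] (Y : 𝓢(Space d, ℝ) → Ω → ℝ) : Prop where
  aemeasurable : ∀ f, AEMeasurable (Y f) P
  linear : ∀ᵐ ω ∂P, ∀ (s t : ℝ) (f g : 𝓢(Space d, ℝ)),
    Y (s • f + t • g) ω = s * Y f ω + t * Y g ω
  continuous_in_law : ∀ (u : ℕ → 𝓢(Space d, ℝ)) (f : 𝓢(Space d, ℝ)),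
    Tendsto u atTop (𝓝 f) →
      TendstoInDistribution (fun n => Y (u n)) atTop (Y f) (fun _ => P) P

/-- The coordinate process `X(f)(ω) = ⟨ω, f⟩` on `𝓢'`. -/
def coord {d : ℕ} (f : 𝓢(Space d, ℝ)) (ω : Tempered d) : ℝ := ω f

/-- `Q` is the probability measure on `(𝓢', 𝓑(𝓢'))` under which the coordinate process is equal in
law to `Y`, that is, has the same characteristic functional. -/
structure IsLawOf {d : ℕ} {Ω : Type*} [MeasurableSpace Ω] (Q : Measure (Tempered d))
    (P : Measure Ω) (Y : 𝓢(Space d, ℝ) → Ω → ℝ) : Prop where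
  isProbabilityMeasure : IsProbabilityMeasure Q
  charFunctional_eq : ∀ f : 𝓢(Space d, ℝ),
    ∫ ω, Complex.exp (Complex.I * (coord f ω : ℂ)) ∂Q
      = ∫ ω, Complex.exp (Complex.I * (Y f ω : ℂ)) ∂P

/-- The random field `Y` has paths in `E ⊆ 𝓢'`: the set `E` has inner measure one under the law of
`Y` on `𝓢'`. -/
def HasPathsIn {d : ℕ} {Ω : Type*} [MeasurableSpace Ω] (P : Measure Ω)
    (Y : 𝓢(Space d, ℝ) → Ω → ℝ) (E : Set (Tempered d)) : Prop :=
  ∃ Q : Measure (Tempered d), IsLawOf Q P Y ∧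
    ⨆ (B : Set (Tempered d)) (_ : MeasurableSet B ∧ B ⊆ E), Q B = 1

/-! ### Convoluted Poisson noise -/

/-- The pure Poisson Lévy characteristic `ψ(t) = z ∫ (e^{ist} - 1) dr(s)` with activity `z` and
Lévy measure `r`. -/
def poissonCharacteristic (z : ℝ) (r : Measure ℝ) (t : ℝ) : ℂ :=
  (z : ℂ) * ∫ s, (Complex.exp (Complex.I * ((s * t : ℝ) : ℂ)) - 1) ∂r

/-- `PF` is the law on `𝓢'` of the Poisson noise `F` with activity `z` and Lévy measure `r`:
`E[e^{i⟨F, f⟩}] = exp (∫ ψ(f(x)) dx)` for all test functions `f`. -/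
structure IsPoissonNoise {d : ℕ} (z : ℝ) (r : Measure ℝ) (PF : Measure (Tempered d)) : Prop where
  isProbabilityMeasure : IsProbabilityMeasure PF
  charFunctional_eq : ∀ f : 𝓢(Space d, ℝ),
    ∫ ω, Complex.exp (Complex.I * (coord f ω : ℂ)) ∂PF
      = Complex.exp (∫ x, poissonCharacteristic z r (f x))

/-- The transposed convolution `(Ğ * f)(x) = ∫ G(y - x) f(y) dy`, where `Ğ(x) = G(-x)`, so that
`⟨G * ω, f⟩ = ⟨ω, Ğ * f⟩`. -/
def transposeConv {d : ℕ} (G : Space d → ℝ) (f : 𝓢(Space d, ℝ)) (x : Space d) : ℝ :=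
  ∫ y, G (y - x) * f y

/-- The pairing `⟨F, h⟩` of the coordinate process `F` under `PF` with an integrable function `h`
that need not be a test function is `Y`: this is the extension of `f ↦ ⟨F, f⟩` from `𝓢` to `L¹(dx)`
along `L¹`-limits of test functions, the values converging in probability. (The extension does not
depend on the sequence when `PF` is a Poisson noise with compactly supported Lévy measure, because
`f ↦ ⟨F, f⟩` is then continuous from the `L¹`-norm to convergence in probability.) -/
def IsPairing {d : ℕ} (PF : Measure (Tempered d)) (h : Space d → ℝ) (Y : Tempered d → ℝ) : Prop :=
  ∃ u : ℕ → 𝓢(Space d, ℝ),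
    Tendsto (fun n => eLpNorm (fun x => u n x - h x) 1 volume) atTop (𝓝 0) ∧
      TendstoInMeasure PF (fun n => coord (u n)) atTop Y

/-- `T` is the map `F ↦ G * F` on the path space of the noise: `⟨G * F, f⟩ = ⟨F, Ğ * f⟩`
almost surely, for every test function `f`. -/
structure IsConvolutionMap {d : ℕ} (G : Space d → ℝ) (PF : Measure (Tempered d))
    (T : Tempered d → Tempered d) : Prop where
  aemeasurable : AEMeasurable T PF
  pairing : ∀ f : 𝓢(Space d, ℝ), IsPairing PF (transposeConv G f) (fun ω => coord f (T ω))

/-- If convolution with `G` maps `𝓢'` continuously to `𝓢'` (for instance if it is the continuous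
inverse `L⁻¹` of an operator `L` on `𝓢'` with Green's function `G`), then the map
`ω ↦ G * ω` is the convolution map in the above sense. -/
theorem isConvolutionMap_of_continuous {d : ℕ} (G : Space d → ℝ) (PF : Measure (Tempered d))
    (T : Tempered d → Tempered d) (hT : Continuous T)
    (hG : ∀ f : 𝓢(Space d, ℝ), ∃ h : 𝓢(Space d, ℝ),
      (∀ x, h x = transposeConv G f x) ∧ ∀ ω, T ω f = ω h) :
    IsConvolutionMap G PF T := by
  refine ⟨hT.measurable.aemeasurable, fun f => ?_⟩
  obtain ⟨h, hh, hTω⟩ := hG f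
  refine ⟨fun _ => h, ?_, ?_⟩
  · simp [hh]
  · have : (fun ω => coord f (T ω)) = coord h := by
      funext ω
      exact hTω ω
    rw [this]
    intro ε hε
    simp [hε.ne']

/-- `PX` is the law on `𝓢'` of the convoluted Poisson noise `X = G * F`, where `F` is the Poisson
noise with activity `z` and Lévy measure `r`. -/
def IsConvolutedPoissonNoise {d : ℕ} (z : ℝ) (r : Measure ℝ) (G : Space d → ℝ)
    (PX : Measure (Tempered d)) : Prop :=
  ∃ (PF : Measure (Tempered d)) (T : Tempered d → Tempered d),
    IsPoissonNoise z r PF ∧ IsConvolutionMap G PF T ∧ PX = PF.map T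

/-! ### Path spaces and local functions of the field -/

/-- The tempered distribution `ω` is given by the locally integrable function `u`. -/
def Represents {d : ℕ} (ω : Tempered d) (u : Space d → ℝ) : Prop :=
  LocallyIntegrable u volume ∧
    ∀ f : 𝓢(Space d, ℝ), Integrable (fun x => u x * f x) volume ∧ ω f = ∫ x, u x * f x

/-- The weight `g_ε(x) = 1 / (1 + |x|²)^{(d + ε) / 2}`. -/
def weight (d : ℕ) (ε : ℝ) (x : Space d) : ℝ :=
  1 / (1 + ‖x‖ ^ 2) ^ (((d : ℝ) + ε) / 2)

/-- The measure `g_ε dx` on `ℝ^d`. -/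
def weightedVolume (d : ℕ) (ε : ℝ) : Measure (Space d) :=
  volume.withDensity (fun x => ENNReal.ofReal (weight d ε x))

/-- `L¹(ℝ^d, g_ε dx)` as a set of tempered distributions. -/
def weightedL1 (d : ℕ) (ε : ℝ) : Set (Tempered d) :=
  {ω | ∃ u : Space d → ℝ, Integrable u (weightedVolume d ε) ∧ Represents ω u}

open Classical in
/-- The function `x ↦ v(X(x))` for the path `X = ω`: if `ω` is given by a function `u` (unique up to
null sets), it is `v ∘ u`; on the other, exceptional, paths it is put equal to zero. -/
def nonlinear {d : ℕ} (v : ℝ → ℝ) (ω : Tempered d) : Space d → ℝ :=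
  if h : ∃ u : Space d → ℝ, Represents ω u then fun x => v (h.choose x) else fun _ => 0

/-- The pairing `⟨v(X), φ⟩ = ∫ v(X(x)) φ(x) dx` as a function of the path `X = ω`. -/
def nonlinearPairing {d : ℕ} (v : ℝ → ℝ) (φ : Space d → ℝ) (ω : Tempered d) : ℝ :=
  ∫ x, nonlinear v ω x * φ x

/-- The random field `v(X)`, `f ↦ ⟨v(X), f⟩`. -/
def nonlinearField {d : ℕ} (v : ℝ → ℝ) (f : 𝓢(Space d, ℝ)) (ω : Tempered d) : ℝ :=
  nonlinearPairing v (fun x => f x) ω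

/-- The interaction `V_Λ = ⟨v(X), 1_Λ⟩`. -/
def interaction {d : ℕ} (v : ℝ → ℝ) (Λ : Set (Space d)) (ω : Tempered d) : ℝ :=
  nonlinearPairing v (Λ.indicator fun _ => 1) ω

/-- The Boltzmann weight `e^{-β V_Λ}`. -/
def boltzmann {d : ℕ} (v : ℝ → ℝ) (Λ : Set (Space d)) (β : ℝ) (ω : Tempered d) : ℝ :=
  Real.exp (-β * interaction v Λ ω)

/-- The partition function `Ξ_Λ = E[e^{-β V_Λ}]`. -/
def partitionFunction {d : ℕ} (v : ℝ → ℝ) (Λ : Set (Space d)) (β : ℝ)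
    (PX : Measure (Tempered d)) : ℝ :=
  ∫ ω, boltzmann v Λ β ω ∂PX

/-- The measure `(e^{-β V_Λ} / Ξ_Λ) P^X`. -/
def interactingLaw {d : ℕ} (v : ℝ → ℝ) (Λ : Set (Space d)) (β : ℝ)
    (PX : Measure (Tempered d)) : Measure (Tempered d) :=
  PX.withDensity (fun ω => ENNReal.ofReal (boltzmann v Λ β ω / partitionFunction v Λ β PX))

end CPN

end

/-!
The field is controlled through its characteristic functional alone
(`IsConvolutedPoissonNoise.charFunctional_eq`). It shows that the values of `X` on finitely many
test functions `Bᵢ` form an infinitely divisible vector without Gaussian part, whose Lévy measure is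
the image of `z r(ds) dx` under `(s, x) ↦ s • ((Ğ * Bᵢ)(x))ᵢ`.
Approximating the Lévy measure by finite ones, the law is a weak limit of compound Poisson laws
`e^{-ν(E)} ∑ₖ ν^{*k} / k!`, and for these the exponential moment of a seminorm `p` is bounded term
by term by `exp ∫ (e^p - 1) dν` (`lintegral_exp_le_of_charFun`, `lintegral_exp_evalVec_le`). Since
the jumps are bounded by `c`, the right-hand side is finite as soon as `p` of the kernels is bounded
and integrable in `x`.

For a single test function this gives, on differentiating the exponential moment at `0`, the bound
`E|X(f)| ≤ z c ‖Ğ * f‖₁` (`lintegral_abs_eval_le`). So `X` smeared with probability densities that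
concentrate at a point `x` is Cauchy in `L¹(P)`, because the kernels converge to `y ↦ G (x - y)` in
`L¹(dy)` by continuity of translations. The smeared fields therefore converge in `L¹(P ⊗ g_ε dx)` to
a jointly measurable `U` (`exists_limit_probeField`). For each fixed test function `f` the same bound
shows `X(f) = ∫ U f` almost surely, and separability of `𝓢` with continuity of both sides in `f`
makes this hold for all `f` simultaneously (`ae_represents`).

For the interaction one needs exponential moments of `∫_Λ |U|`. Jensen's inequality is useless here,
since `G` may be unbounded and then `X(x)` need not have exponential moments. However, `∫_Λ |X(x)| dx`,
with `X` smeared by densities chosen from a finite family, is itself a seminorm of finitely many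
values of the field, and on the kernels this seminorm is bounded by a multiple of `‖G‖₁`, as
integrating over `Λ` removes the singularities of `G`. The resulting bound is uniform in the
smearing and passes to `U` by Fatou (`lintegral_exp_setIntegral_lt_top`).

The law of a field given by a jointly measurable function with sections in `L¹(g_ε dx)` is the image
of a law on the Polish space `L¹(g_ε dx)` under its continuous inclusion into `𝓢'`; tightness
provides compact sets of nearly full measure, whose images are closed in `𝓢'`. This gives the path
property both for `X` and for `v(X)` (`isRandomField_and_hasPathsIn`) and avoids any comparison of
the Borel and the cylinder σ-algebra on `𝓢'`.
-/

noncomputable section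

namespace CPN

/-! ### Compound Poisson laws -/

section CompoundPoisson

variable {E : Type*} [NormedAddCommGroup E] [MeasurableSpace E] [BorelSpace E]
  [SecondCountableTopology E]

/-- The `k`-fold convolution power of a measure, with `convPow ν 0` the unit mass at the origin. -/
def convPow (ν : Measure E) : ℕ → Measure E
  | 0 => Measure.dirac 0
  | k + 1 => (convPow ν k).conv ν

instance isFiniteMeasure_convPow (ν : Measure E) [IsFiniteMeasure ν] (k : ℕ) :
    IsFiniteMeasure (convPow ν k) := by
  induction k with
  | zero => unfold convPow; infer_instance
  | succ k ih => unfold convPow; infer_instance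

lemma convPow_univ (ν : Measure E) [IsFiniteMeasure ν] (k : ℕ) :
    convPow ν k Set.univ = ν Set.univ ^ k := by
  induction k with
  | zero => simp [convPow]
  | succ k ih =>
    rw [convPow, ← lintegral_one, Measure.lintegral_conv measurable_const]
    simp [ih, pow_succ, mul_comm]

/-- A submultiplicative function integrates submultiplicatively against convolution powers. -/
lemma lintegral_convPow_le (ν : Measure E) [IsFiniteMeasure ν] {g : E → ℝ≥0∞} (hg : Measurable g)
    (hg0 : g 0 ≤ 1) (hgadd : ∀ x y, g (x + y) ≤ g x * g y) (k : ℕ) :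
    ∫⁻ x, g x ∂(convPow ν k) ≤ (∫⁻ x, g x ∂ν) ^ k := by
  induction k with
  | zero => simpa [convPow, lintegral_dirac' _ hg] using hg0
  | succ k ih =>
    rw [convPow, Measure.lintegral_conv hg, pow_succ]
    calc ∫⁻ x, ∫⁻ y, g (x + y) ∂ν ∂(convPow ν k)
        ≤ ∫⁻ x, ∫⁻ y, g x * g y ∂ν ∂(convPow ν k) :=
          lintegral_mono fun x => lintegral_mono fun y => hgadd x y
      _ = (∫⁻ x, g x ∂(convPow ν k)) * ∫⁻ y, g y ∂ν := by
          simp_rw [lintegral_const_mul _ hg]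
          rw [lintegral_mul_const _ hg]
      _ ≤ _ := by gcongr

lemma tsum_inv_factorial_mul_ofReal_pow {A : ℝ} (hA : 0 ≤ A) :
    ∑' k : ℕ, ((k.factorial : ℝ≥0∞))⁻¹ * ENNReal.ofReal A ^ k = ENNReal.ofReal (Real.exp A) := by
  have h1 : ∀ k : ℕ, ((k.factorial : ℝ≥0∞))⁻¹ * ENNReal.ofReal A ^ k
      = ENNReal.ofReal (A ^ k / k.factorial) := by
    intro k
    have hk : (0 : ℝ) < k.factorial := by exact_mod_cast k.factorial_pos
    rw [ENNReal.ofReal_div_of_pos hk, ENNReal.ofReal_pow hA, ENNReal.ofReal_natCast,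
      ENNReal.div_eq_inv_mul]
  simp_rw [h1]
  rw [← ENNReal.ofReal_tsum_of_nonneg (fun k => by positivity) (Real.summable_pow_div_factorial A),
    Real.exp_eq_exp_ℝ, NormedSpace.exp_eq_tsum_div]

/-- The compound Poisson law with finite Lévy measure `ν`, the law of the sum of a Poisson number
of independent jumps: `e^{-ν(E)} ∑ₖ ν^{*k} / k!`. -/
def compoundPoisson (ν : Measure E) : Measure E :=
  ENNReal.ofReal (Real.exp (-ν.real Set.univ)) •
    Measure.sum (fun k : ℕ => ((k.factorial : ℝ≥0∞))⁻¹ • convPow ν k)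

instance isProbabilityMeasure_compoundPoisson (ν : Measure E) [IsFiniteMeasure ν] :
    IsProbabilityMeasure (compoundPoisson ν) := by
  constructor
  have h : ν Set.univ = ENNReal.ofReal (ν.real Set.univ) := by simp
  simp only [compoundPoisson, Measure.smul_apply, Measure.sum_apply _ MeasurableSet.univ,
    convPow_univ, smul_eq_mul]
  rw [h, tsum_inv_factorial_mul_ofReal_pow measureReal_nonneg, ← ENNReal.ofReal_mul (by positivity),
    ← Real.exp_add]
  simp

lemma lintegral_compoundPoisson_le (ν : Measure E) [IsFiniteMeasure ν] {g : E → ℝ≥0∞}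
    (hg : Measurable g) (hg0 : g 0 ≤ 1) (hgadd : ∀ x y, g (x + y) ≤ g x * g y) {A : ℝ}
    (hA : 0 ≤ A) (hgA : ∫⁻ x, g x ∂ν ≤ ENNReal.ofReal A) :
    ∫⁻ x, g x ∂(compoundPoisson ν) ≤ ENNReal.ofReal (Real.exp (A - ν.real Set.univ)) := by
  simp only [compoundPoisson, lintegral_smul_measure, lintegral_sum_measure, smul_eq_mul]
  calc _ ≤ ENNReal.ofReal (Real.exp (-ν.real Set.univ)) *
        ∑' k : ℕ, ((k.factorial : ℝ≥0∞))⁻¹ * ENNReal.ofReal A ^ k := by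
        gcongr with k
        exact (lintegral_convPow_le ν hg hg0 hgadd k).trans (by gcongr)
    _ = _ := by
        rw [tsum_inv_factorial_mul_ofReal_pow hA, ← ENNReal.ofReal_mul (by positivity),
          ← Real.exp_add]
        ring_nf

variable [InnerProductSpace ℝ E]

lemma charFun_convPow (ν : Measure E) [IsFiniteMeasure ν] (k : ℕ) (t : E) :
    charFun (convPow ν k) t = charFun ν t ^ k := by
  induction k with
  | zero => simp [convPow]
  | succ k ih => rw [convPow, charFun_conv, ih, pow_succ]

lemma charFun_compoundPoisson (ν : Measure E) [IsFiniteMeasure ν] (t : E) :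
    charFun (compoundPoisson ν) t = Complex.exp (charFun ν t - ν.real Set.univ) := by
  have hint : Integrable (fun x => Complex.exp (inner ℝ x t * Complex.I)) (compoundPoisson ν) := by
    refine Integrable.of_bound (by fun_prop) 1 (ae_of_all _ fun x => ?_)
    rw [Complex.norm_exp_ofReal_mul_I]
  have hc : ENNReal.ofReal (Real.exp (-ν.real Set.univ)) ≠ 0 := by
    simp [Real.exp_pos]
  have hint' := (integrable_smul_measure hc ENNReal.ofReal_ne_top).1 hint
  have hs := hasSum_integral_measure hint'
  have hterm : ∀ k : ℕ, ∫ x, Complex.exp (inner ℝ x t * Complex.I)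
      ∂(((k.factorial : ℝ≥0∞))⁻¹ • convPow ν k) = charFun ν t ^ k / k.factorial := by
    intro k
    rw [integral_smul_measure, ← charFun_apply, charFun_convPow, ENNReal.toReal_inv,
      ENNReal.toReal_natCast]
    simp [div_eq_inv_mul]
  simp_rw [hterm] at hs
  have he : ∑' k : ℕ, charFun ν t ^ k / (k.factorial : ℂ) = Complex.exp (charFun ν t) := by
    rw [Complex.exp_eq_exp_ℂ, NormedSpace.exp_eq_tsum_div]
  rw [charFun_apply, compoundPoisson, integral_smul_measure, ← hs.tsum_eq, he,
    ENNReal.toReal_ofReal (by positivity), sub_eq_add_neg, add_comm, Complex.exp_add]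
  simp

end CompoundPoisson

/-! ### Exponential moments of infinitely divisible laws -/

section LevyBound

variable {E : Type*} [NormedAddCommGroup E] [InnerProductSpace ℝ E] [MeasurableSpace E]
  [BorelSpace E] [FiniteDimensional ℝ E]

/-- The integrand of the Lévy–Khinchine exponent is dominated by the jump size. -/
lemma norm_exp_ofReal_mul_I_sub_one_le (x : ℝ) : ‖Complex.exp (x * Complex.I) - 1‖ ≤ |x| := by
  have := Real.norm_exp_I_mul_ofReal_sub_one_le (x := x)
  rwa [mul_comm, Real.norm_eq_abs] at this

/-- Exponential moments of an infinitely divisible law with Lévy measure `m.map K` (no Gaussian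
part, integrable jumps, no drift) along a continuous subadditive function `p` are bounded by those
of the Lévy measure. The law is a weak limit of compound Poisson laws, for which the bound holds
term by term in the exponential series. -/
theorem lintegral_exp_le_of_charFun {Z : Type*} [MeasurableSpace Z] {m : Measure Z} [SigmaFinite m]
    {K : Z → E} (hKm : Measurable K) (hK : Integrable K m) (μ : Measure E) [IsProbabilityMeasure μ]
    (hμ : ∀ t, charFun μ t
      = Complex.exp (∫ z, (Complex.exp (inner ℝ (K z) t * Complex.I) - 1) ∂m))
    {p : E → ℝ} (hp : Continuous p) (hp0 : p 0 = 0) (hpadd : ∀ x y, p (x + y) ≤ p x + p y)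
    (hpos : ∀ x, 0 ≤ p x)
    {A : ℝ} (hA : ∫⁻ z, ENNReal.ofReal (Real.exp (p (K z)) - 1) ∂m ≤ ENNReal.ofReal A)
    (hA0 : 0 ≤ A) :
    ∫⁻ x, ENNReal.ofReal (Real.exp (p x)) ∂μ ≤ ENNReal.ofReal (Real.exp A) := by
  have : ProperSpace E := FiniteDimensional.proper_rclike ℝ E
  have : SecondCountableTopology E := inferInstance
  let S := spanningSets m
  let ν : ℕ → Measure E := fun n => (m.restrict (S n)).map K
  have hfin : ∀ n, IsFiniteMeasure (m.restrict (S n)) := fun n =>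
    ⟨by simpa using measure_spanningSets_lt_top m n⟩
  have hνf : ∀ n, IsFiniteMeasure (ν n) := fun n => by dsimp [ν]; infer_instance
  have hmass : ∀ n, (ν n).real Set.univ = (m.restrict (S n)).real Set.univ := fun n => by
    simp [ν, Measure.real, Measure.map_apply hKm MeasurableSet.univ]
  have hjump : ∀ t, Integrable (fun z => Complex.exp (inner ℝ (K z) t * Complex.I) - 1) m := by
    intro t
    refine (hK.norm.mul_const ‖t‖).mono' ?_ (ae_of_all _ fun z => ?_)
    · have : Measurable fun z => inner ℝ (K z) t := by fun_prop
      fun_prop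
    · refine (norm_exp_ofReal_mul_I_sub_one_le _).trans ?_
      exact abs_real_inner_le_norm _ _
  have hchar : ∀ n t, charFun (compoundPoisson (ν n)) t
      = Complex.exp (∫ z in S n, (Complex.exp (inner ℝ (K z) t * Complex.I) - 1) ∂m) := by
    intro n t
    rw [charFun_compoundPoisson, integral_sub, hmass, charFun_apply, integral_map hKm.aemeasurable
      (by fun_prop)]
    · simp
    · refine Integrable.of_bound ?_ 1 (ae_of_all _ fun x => ?_)
      · have : Measurable fun z => inner ℝ (K z) t := by fun_prop
        fun_prop
      · rw [Complex.norm_exp_ofReal_mul_I]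
    · exact integrable_const _
  have hlim : ∀ t, Tendsto (fun n => charFun (compoundPoisson (ν n)) t) atTop
      (𝓝 (charFun μ t)) := by
    intro t
    simp_rw [hchar, hμ]
    refine (Complex.continuous_exp.tendsto _).comp ?_
    have := tendsto_setIntegral_of_monotone (μ := m)
      (f := fun z => Complex.exp (inner ℝ (K z) t * Complex.I) - 1)
      (fun n => measurableSet_spanningSets m n) (monotone_spanningSets m)
      ((hjump t).integrableOn)
    simpa [iUnion_spanningSets, S] using this
  let P : ℕ → ProbabilityMeasure E := fun n => ⟨compoundPoisson (ν n), inferInstance⟩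
  have hP : Tendsto P atTop (𝓝 ⟨μ, inferInstance⟩) :=
    ProbabilityMeasure.tendsto_of_tendsto_charFun hlim
  have hg : Measurable fun x => ENNReal.ofReal (Real.exp (p x)) := by
    have := hp.measurable
    fun_prop
  have hbound : ∀ n, ∫⁻ x, ENNReal.ofReal (Real.exp (p x)) ∂(compoundPoisson (ν n))
      ≤ ENNReal.ofReal (Real.exp A) := by
    intro n
    have h := lintegral_compoundPoisson_le (ν n) (g := fun x => ENNReal.ofReal (Real.exp (p x))) hg
      (by simp [hp0]) (fun x y => by
        rw [← ENNReal.ofReal_mul (by positivity), ← Real.exp_add]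
        exact ENNReal.ofReal_le_ofReal (Real.exp_le_exp.2 (hpadd x y)))
      (A := A + (ν n).real Set.univ) (by positivity) ?_
    · simpa using h
    · rw [lintegral_map hg hKm, ENNReal.ofReal_add hA0 measureReal_nonneg]
      have h1 : ∀ z, ENNReal.ofReal (Real.exp (p (K z)))
          = ENNReal.ofReal (Real.exp (p (K z)) - 1) + 1 := by
        intro z
        rw [← ENNReal.ofReal_one, ← ENNReal.ofReal_add _ zero_le_one]
        · simp
        · simpa using hpos (K z)
      simp_rw [h1]
      rw [lintegral_add_right _ measurable_const, lintegral_one, hmass, ofReal_measureReal]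
      gcongr
      exact (setLIntegral_le_lintegral _ _).trans hA
  have := lintegral_le_liminf_lintegral_of_forall_isOpen_measure_le_liminf_measure
    (μ := μ) (μs := fun n => compoundPoisson (ν n)) (f := fun x => Real.exp (p x))
    (by fun_prop) (fun x => by positivity)
    (fun G hG => ProbabilityMeasure.le_liminf_measure_open_of_tendsto hP hG)
  refine this.trans ?_
  refine (liminf_le_liminf (Eventually.of_forall hbound)).trans ?_
  simp

end LevyBound

/-! ### Transposed convolution with an integrable kernel -/

section TransposeConv

variable {d : ℕ} {G : Space d → ℝ}

lemma transposeConv_congr_ae {G' : Space d → ℝ} (h : G =ᵐ[volume] G') :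
    transposeConv G = transposeConv G' := by
  funext f x
  refine integral_congr_ae ?_
  filter_upwards [(measurePreserving_sub_right volume x).quasiMeasurePreserving.ae h] with y hy
  rw [hy]

lemma exists_bound_schwartz (f : 𝓢(Space d, ℝ)) : ∃ C, 0 ≤ C ∧ ∀ x, ‖f x‖ ≤ C :=
  ⟨SchwartzMap.seminorm ℝ 0 0 f, apply_nonneg _ _, fun x => f.norm_le_seminorm ℝ x⟩

lemma integrable_comp_sub_mul (hG : Integrable G volume) (f : 𝓢(Space d, ℝ)) (x : Space d) :
    Integrable (fun y => G (y - x) * f y) volume := by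
  obtain ⟨C, -, hC⟩ := exists_bound_schwartz f
  exact (hG.comp_sub_right x).mul_bdd f.continuous.aestronglyMeasurable (ae_of_all _ hC)

lemma transposeConv_sum {ι : Type*} (s : Finset ι) (hG : Integrable G volume)
    (B : ι → 𝓢(Space d, ℝ)) (t : ι → ℝ) (x : Space d) :
    transposeConv G (∑ i ∈ s, t i • B i) x = ∑ i ∈ s, t i * transposeConv G (B i) x := by
  simp only [transposeConv]
  simp_rw [← integral_const_mul]
  rw [← integral_finsetSum]
  · refine integral_congr_ae (ae_of_all _ fun y => ?_)
    simp only [_root_.sum_apply, _root_.smul_apply, smul_eq_mul, Finset.mul_sum]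
    exact Finset.sum_congr rfl fun i _ => by ring
  · exact fun i _ => (integrable_comp_sub_mul hG (B i) x).const_mul _

lemma transposeConv_sub (hG : Integrable G volume) (f g : 𝓢(Space d, ℝ)) (x : Space d) :
    transposeConv G (f - g) x = transposeConv G f x - transposeConv G g x := by
  simp only [transposeConv]
  rw [← integral_sub (integrable_comp_sub_mul hG f x) (integrable_comp_sub_mul hG g x)]
  simp [mul_sub]

lemma measurable_transposeConv (hGm : Measurable G) (f : 𝓢(Space d, ℝ)) :
    Measurable (transposeConv G f) := by
  have : StronglyMeasurable (Function.uncurry fun x y : Space d => G (y - x) * f y) := by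
    have hf := f.continuous.measurable
    refine Measurable.stronglyMeasurable ?_
    unfold Function.uncurry
    fun_prop
  exact this.integral_prod_right.measurable

lemma lintegral_transposeConv_le (hGm : Measurable G) (f : 𝓢(Space d, ℝ)) :
    ∫⁻ x, ‖transposeConv G f x‖ₑ ≤ (∫⁻ x, ‖G x‖ₑ) * ∫⁻ y, ‖f y‖ₑ := by
  have hf := f.continuous.measurable
  calc ∫⁻ x, ‖transposeConv G f x‖ₑ
      ≤ ∫⁻ x, ∫⁻ y, ‖G (y - x)‖ₑ * ‖f y‖ₑ := by
        refine lintegral_mono fun x => (enorm_integral_le_lintegral_enorm _).trans_eq ?_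
        simp
    _ = ∫⁻ y, ∫⁻ x, ‖G (y - x)‖ₑ * ‖f y‖ₑ := by
        refine lintegral_lintegral_swap ?_
        refine Measurable.aemeasurable ?_
        unfold Function.uncurry
        fun_prop
    _ = ∫⁻ y, (∫⁻ x, ‖G x‖ₑ) * ‖f y‖ₑ := by
        refine lintegral_congr fun y => ?_
        rw [lintegral_mul_const _ (by fun_prop)]
        congr 1
        exact lintegral_sub_left_eq_self (fun x => ‖G x‖ₑ) y
    _ = _ := lintegral_const_mul _ (by fun_prop)

lemma integrable_transposeConv (hGm : Measurable G) (hG : Integrable G volume)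
    (f : 𝓢(Space d, ℝ)) : Integrable (transposeConv G f) volume := by
  refine ⟨(measurable_transposeConv hGm f).aestronglyMeasurable, ?_⟩
  exact (lintegral_transposeConv_le hGm f).trans_lt (ENNReal.mul_lt_top hG.2 f.integrable.2)

lemma abs_transposeConv_le (hG : Integrable G volume) {f : 𝓢(Space d, ℝ)} {C : ℝ}
    (hC : ∀ x, ‖f x‖ ≤ C) (x : Space d) :
    |transposeConv G f x| ≤ C * ∫ y, ‖G y‖ := by
  calc |transposeConv G f x| ≤ ∫ y, ‖G (y - x) * f y‖ := by
        rw [← Real.norm_eq_abs]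
        exact norm_integral_le_integral_norm _
    _ ≤ ∫ y, C * ‖G (y - x)‖ := by
        refine integral_mono (integrable_comp_sub_mul hG f x).norm
          ((hG.comp_sub_right x).norm.const_mul C) fun y => ?_
        simp only [norm_mul]
        rw [mul_comm]
        gcongr
        exact hC y
    _ = C * ∫ y, ‖G y‖ := by
        rw [integral_const_mul]
        congr 1
        exact integral_sub_right_eq_self (fun y => ‖G y‖) x

end TransposeConv

/-! ### The characteristic functional of convoluted Poisson noise -/

section CharFunctional

variable {d : ℕ} {z c : ℝ} {r : Measure ℝ}

lemma poissonCharacteristic_zero : poissonCharacteristic z r 0 = 0 := by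
  simp [poissonCharacteristic]

variable [IsProbabilityMeasure r]

lemma integrable_exp_sub_one (t : ℝ) :
    Integrable (fun s : ℝ => Complex.exp (Complex.I * ((s * t : ℝ) : ℂ)) - 1) r := by
  refine Integrable.of_bound (by fun_prop) 2 (ae_of_all _ fun s => ?_)
  rw [mul_comm]
  refine (norm_sub_le _ _).trans ?_
  rw [Complex.norm_exp_ofReal_mul_I, norm_one]
  norm_num

/-- With jumps bounded by `c`, the Poisson characteristic is Lipschitz with constant `z * c`. -/
lemma norm_poissonCharacteristic_sub_le (hz : 0 ≤ z) (hr : ∀ᵐ s ∂r, |s| ≤ c) (t t' : ℝ) :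
    ‖poissonCharacteristic z r t - poissonCharacteristic z r t'‖ ≤ z * c * |t - t'| := by
  simp only [poissonCharacteristic]
  rw [← mul_sub, norm_mul, Complex.norm_real, Real.norm_of_nonneg hz, mul_assoc,
    ← integral_sub (integrable_exp_sub_one t) (integrable_exp_sub_one t')]
  gcongr
  have := norm_integral_le_of_norm_le_const (μ := r) (C := c * |t - t'|)
    (f := fun s : ℝ => Complex.exp (Complex.I * ((s * t : ℝ) : ℂ)) - 1
      - (Complex.exp (Complex.I * ((s * t' : ℝ) : ℂ)) - 1)) ?_
  · simpa using this
  · filter_upwards [hr] with s hs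
    have h1 : Complex.exp (Complex.I * ((s * t : ℝ) : ℂ)) - 1
      - (Complex.exp (Complex.I * ((s * t' : ℝ) : ℂ)) - 1)
      = Complex.exp (((s * t' : ℝ) : ℂ) * Complex.I) *
        (Complex.exp (((s * (t - t') : ℝ) : ℂ) * Complex.I) - 1) := by
      rw [mul_sub, ← Complex.exp_add]
      push_cast
      ring_nf
    rw [h1, norm_mul, Complex.norm_exp_ofReal_mul_I, one_mul]
    refine (norm_exp_ofReal_mul_I_sub_one_le _).trans ?_
    rw [abs_mul]
    gcongr

lemma continuous_poissonCharacteristic (hz : 0 ≤ z) (hr : ∀ᵐ s ∂r, |s| ≤ c) :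
    Continuous (poissonCharacteristic z r) := by
  rw [Metric.continuous_iff']
  intro t ε hε
  have : Tendsto (fun t' => z * c * |t' - t|) (𝓝 t) (𝓝 (z * c * |t - t|)) := by
    have : Continuous fun t' => z * c * |t' - t| := by fun_prop
    exact this.tendsto t
  simp only [sub_self, abs_zero, mul_zero] at this
  filter_upwards [this.eventually_lt_const hε] with t' ht'
  rw [dist_eq_norm]
  exact (norm_poissonCharacteristic_sub_le hz hr t' t).trans_lt ht'

lemma integrable_poissonCharacteristic_comp (hz : 0 ≤ z) (hr : ∀ᵐ s ∂r, |s| ≤ c)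
    {h : Space d → ℝ} (hh : Integrable h volume) :
    Integrable (fun x => poissonCharacteristic z r (h x)) volume := by
  refine (hh.norm.const_mul (z * c)).mono'
    ((continuous_poissonCharacteristic hz hr).comp_aestronglyMeasurable hh.1)
    (ae_of_all _ fun x => ?_)
  have := norm_poissonCharacteristic_sub_le hz hr (h x) 0
  simpa [poissonCharacteristic_zero] using this

lemma tendsto_integral_poissonCharacteristic (hz : 0 ≤ z) (hr : ∀ᵐ s ∂r, |s| ≤ c)
    {h : Space d → ℝ} (hh : Integrable h volume) {u : ℕ → 𝓢(Space d, ℝ)}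
    (hu : Tendsto (fun n => eLpNorm (fun x => u n x - h x) 1 volume) atTop (𝓝 0)) :
    Tendsto (fun n => ∫ x, poissonCharacteristic z r (u n x)) atTop
      (𝓝 (∫ x, poissonCharacteristic z r (h x))) := by
  refine tendsto_integral_of_L1' _ (integrable_poissonCharacteristic_comp hz hr hh).1
    (Eventually.of_forall fun n => integrable_poissonCharacteristic_comp hz hr (u n).integrable) ?_
  have hlim : Tendsto (fun n => ENNReal.ofReal (z * c) *
      eLpNorm (fun x => u n x - h x) 1 volume) atTop (𝓝 0) := by
    simpa using ENNReal.Tendsto.const_mul hu (Or.inr ENNReal.ofReal_ne_top)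
  refine tendsto_of_tendsto_of_tendsto_of_le_of_le tendsto_const_nhds hlim
    (fun _ => zero_le) fun n => ?_
  exact eLpNorm_le_mul_eLpNorm_of_ae_le_mul (ae_of_all _ fun x => by
    simpa using norm_poissonCharacteristic_sub_le hz hr (u n x) (h x)) 1

/-- The characteristic functional of convoluted Poisson noise. -/
theorem IsConvolutedPoissonNoise.charFunctional_eq {G : Space d → ℝ} (hGm : Measurable G)
    (hG : Integrable G volume) (hz : 0 ≤ z) (hr : ∀ᵐ s ∂r, |s| ≤ c) {PX : Measure (Tempered d)}
    (hX : IsConvolutedPoissonNoise z r G PX) (f : 𝓢(Space d, ℝ)) :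
    ∫ ω, Complex.exp (Complex.I * (ω f : ℂ)) ∂PX
      = Complex.exp (∫ x, poissonCharacteristic z r (transposeConv G f x)) := by
  obtain ⟨PF, T, hF, hT, rfl⟩ := hX
  have := hF.isProbabilityMeasure
  obtain ⟨u, hu, huT⟩ := hT.pairing f
  obtain ⟨ns, hns, hae⟩ := huT.exists_seq_tendsto_ae
  have hcont : ∀ g : 𝓢(Space d, ℝ), Continuous fun ω : Tempered d => ω g :=
    fun g => WeakDual.eval_continuous g
  have hmeas : ∀ g : 𝓢(Space d, ℝ),
      Continuous fun ω : Tempered d => Complex.exp (Complex.I * (ω g : ℂ)) := by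
    exact fun g => Complex.continuous_exp.comp
      (continuous_const.mul (Complex.continuous_ofReal.comp (hcont g)))
  rw [integral_map hT.aemeasurable (hmeas f).measurable.aestronglyMeasurable]
  have h1 : Tendsto (fun n => ∫ ω, Complex.exp (Complex.I * (coord (u (ns n)) ω : ℂ)) ∂PF) atTop
      (𝓝 (∫ ω, Complex.exp (Complex.I * ((T ω) f : ℂ)) ∂PF)) := by
    refine tendsto_integral_of_dominated_convergence (fun _ => 1)
      (fun n => (hmeas (u (ns n))).measurable.aestronglyMeasurable) (integrable_const _)
      (fun n => ae_of_all _ fun ω => ?_) ?_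
    · rw [mul_comm, Complex.norm_exp_ofReal_mul_I]
    · filter_upwards [hae] with ω hω
      have : Continuous fun y : ℝ => Complex.exp (Complex.I * (y : ℂ)) := by fun_prop
      exact (this.tendsto _).comp hω
  have h2 := (Complex.continuous_exp.tendsto _).comp
    ((tendsto_integral_poissonCharacteristic hz hr (integrable_transposeConv hGm hG f) hu).comp
      hns.tendsto_atTop)
  refine tendsto_nhds_unique h1 (h2.congr fun n => ?_)
  simp only [Function.comp]
  exact (hF.charFunctional_eq _).symm

end CharFunctional

/-! ### Moments of finitely many values of the field -/

section Moments

variable {d : ℕ} {ι : Type*}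

/-- The vector of values of a distribution on a finite family of test functions. -/
def evalVec (B : ι → 𝓢(Space d, ℝ)) (ω : Tempered d) : EuclideanSpace ℝ ι :=
  WithLp.toLp 2 fun i => ω (B i)

/-- The vector of transposed convolutions of a finite family of test functions: the jump that a
unit point mass of the noise at `x` causes in `evalVec B`. -/
def kernelVec (G : Space d → ℝ) (B : ι → 𝓢(Space d, ℝ)) (x : Space d) : EuclideanSpace ℝ ι :=
  WithLp.toLp 2 fun i => transposeConv G (B i) x

lemma continuous_evalVec (B : ι → 𝓢(Space d, ℝ)) : Continuous (evalVec B) :=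
  (PiLp.continuous_toLp 2 _).comp (continuous_pi fun i => WeakDual.eval_continuous (B i))

variable [Fintype ι] {G : Space d → ℝ}

lemma measurable_kernelVec (hGm : Measurable G) (B : ι → 𝓢(Space d, ℝ)) :
    Measurable (kernelVec G B) :=
  (PiLp.continuous_toLp 2 _).measurable.comp
    (measurable_pi_lambda _ fun i => measurable_transposeConv hGm (B i))

lemma integrable_kernelVec (hGm : Measurable G) (hG : Integrable G volume)
    (B : ι → 𝓢(Space d, ℝ)) : Integrable (kernelVec G B) volume := by
  have h : Integrable (fun x => fun i => transposeConv G (B i) x) volume :=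
    Integrable.of_eval fun i => integrable_transposeConv hGm hG (B i)
  exact (PiLp.continuousLinearEquiv 2 ℝ
    (fun _ : ι => ℝ)).symm.toContinuousLinearMap.integrable_comp h

variable {z c : ℝ} {r : Measure ℝ} [IsProbabilityMeasure r] {PX : Measure (Tempered d)}

/-- Finite-dimensional distributions of the field are infinitely divisible, with Lévy measure the
image of `z r(ds) dx` under `(s, x) ↦ s • kernelVec G B x`. -/
lemma charFun_map_evalVec (hGm : Measurable G) (hG : Integrable G volume) (hz : 0 ≤ z)
    (hX : ∀ f : 𝓢(Space d, ℝ), ∫ ω, Complex.exp (Complex.I * (ω f : ℂ)) ∂PX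
      = Complex.exp (∫ x, poissonCharacteristic z r (transposeConv G f x)))
    (B : ι → 𝓢(Space d, ℝ)) (t : EuclideanSpace ℝ ι)
    (hK : Integrable (fun w : ℝ × Space d => w.1 • kernelVec G B w.2)
      ((ENNReal.ofReal z • r).prod volume)) :
    charFun (PX.map (evalVec B)) t = Complex.exp (∫ w : ℝ × Space d,
      (Complex.exp (inner ℝ (w.1 • kernelVec G B w.2) t * Complex.I) - 1)
        ∂((ENNReal.ofReal z • r).prod volume)) := by
  have hval : ∀ ω : Tempered d, inner ℝ (evalVec B ω) t = ω (∑ i, t i • B i) := by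
    intro ω
    simp [evalVec, PiLp.inner_apply, map_sum]
  have hker : ∀ x, inner ℝ (kernelVec G B x) t = transposeConv G (∑ i, t i • B i) x := by
    intro x
    rw [transposeConv_sum _ hG]
    simp [kernelVec, PiLp.inner_apply]
  rw [charFun_apply, integral_map (continuous_evalVec B).measurable.aemeasurable (by fun_prop)]
  simp_rw [hval]
  have h1 := hX (∑ i, t i • B i)
  simp_rw [mul_comm Complex.I] at h1
  rw [h1]
  congr 1
  have hint : Integrable (fun w : ℝ × Space d =>
      Complex.exp (inner ℝ (w.1 • kernelVec G B w.2) t * Complex.I) - 1)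
      ((ENNReal.ofReal z • r).prod volume) := by
    refine (hK.norm.mul_const ‖t‖).mono' ?_ (ae_of_all _ fun w => ?_)
    · have := measurable_kernelVec hGm B
      have : Measurable fun w : ℝ × Space d => inner ℝ (w.1 • kernelVec G B w.2) t := by fun_prop
      fun_prop
    · exact (norm_exp_ofReal_mul_I_sub_one_le _).trans (abs_real_inner_le_norm _ _)
  rw [integral_prod_symm _ hint]
  refine integral_congr_ae (ae_of_all _ fun x => ?_)
  simp only [poissonCharacteristic, inner_smul_left, hker]
  rw [integral_smul_measure, ENNReal.toReal_ofReal hz]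
  simp [mul_comm Complex.I]

variable [IsProbabilityMeasure PX]

lemma exp_sub_one_le_mul_exp (t : ℝ) : Real.exp t - 1 ≤ t * Real.exp t := by
  have h1 := Real.add_one_le_exp (-t)
  have h2 : Real.exp (-t) * Real.exp t = 1 := by rw [← Real.exp_add]; simp
  nlinarith [Real.exp_pos t]

/-- Exponential moments of an absolutely homogeneous, subadditive function of finitely many values
of the field, in terms of the supremum and the integral of the same function of the kernels. -/
theorem lintegral_exp_evalVec_le (hGm : Measurable G) (hG : Integrable G volume) (hz : 0 ≤ z)
    (hc : 0 ≤ c) (hr : ∀ᵐ s ∂r, |s| ≤ c)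
    (hX : ∀ f : 𝓢(Space d, ℝ), ∫ ω, Complex.exp (Complex.I * (ω f : ℂ)) ∂PX
      = Complex.exp (∫ x, poissonCharacteristic z r (transposeConv G f x)))
    (B : ι → 𝓢(Space d, ℝ)) {p : EuclideanSpace ℝ ι → ℝ} (hp : Continuous p)
    (hpadd : ∀ x y, p (x + y) ≤ p x + p y) (hpos : ∀ x, 0 ≤ p x)
    (hsmul : ∀ (s : ℝ) x, p (s • x) = |s| * p x) {M K : ℝ} (hK0 : 0 ≤ K)
    (hM : ∀ x, p (kernelVec G B x) ≤ M)
    (hK : ∫⁻ x, ENNReal.ofReal (p (kernelVec G B x)) ≤ ENNReal.ofReal K) :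
    ∫⁻ ω, ENNReal.ofReal (Real.exp (p (evalVec B ω))) ∂PX
      ≤ ENNReal.ofReal (Real.exp (z * c * K * Real.exp (c * M))) := by
  have hH := measurable_kernelVec hGm B
  have hr' : ∀ᵐ s ∂(ENNReal.ofReal z • r), |s| ≤ c := Measure.ae_smul_measure hr _
  have : SigmaFinite (ENNReal.ofReal z • r) := by
    have : IsFiniteMeasure (ENNReal.ofReal z • r) := Measure.smul_finite _ ENNReal.ofReal_ne_top
    infer_instance
  have hKm : Measurable fun w : ℝ × Space d => w.1 • kernelVec G B w.2 := by fun_prop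
  have hid : Integrable (fun s : ℝ => s) (ENNReal.ofReal z • r) :=
    (Integrable.of_bound (by fun_prop) c hr).smul_measure ENNReal.ofReal_ne_top
  have hKint : Integrable (fun w : ℝ × Space d => w.1 • kernelVec G B w.2)
      ((ENNReal.ofReal z • r).prod volume) := hid.smul_prod (integrable_kernelVec hGm hG B)
  have hprob : IsProbabilityMeasure (PX.map (evalVec B)) :=
    Measure.isProbabilityMeasure_map (continuous_evalVec B).measurable.aemeasurable
  have hpm := hp.measurable
  have key := lintegral_exp_le_of_charFun hKm hKint (PX.map (evalVec B))
    (fun t => charFun_map_evalVec hGm hG hz hX B t hKint) hp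
    (by simpa using hsmul 0 0) hpadd hpos (A := z * c * K * Real.exp (c * M)) ?_ (by positivity)
  · rwa [lintegral_map (by fun_prop) (continuous_evalVec B).measurable] at key
  · rw [lintegral_prod _ (by fun_prop)]
    calc ∫⁻ s, (∫⁻ x, ENNReal.ofReal (Real.exp (p (s • kernelVec G B x)) - 1))
          ∂(ENNReal.ofReal z • r)
        ≤ ∫⁻ _, ENNReal.ofReal (c * K * Real.exp (c * M)) ∂(ENNReal.ofReal z • r) := by
          refine lintegral_mono_ae ?_
          filter_upwards [hr'] with s hs
          calc ∫⁻ x, ENNReal.ofReal (Real.exp (p (s • kernelVec G B x)) - 1)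
              ≤ ∫⁻ x, ENNReal.ofReal (c * Real.exp (c * M)) *
                  ENNReal.ofReal (p (kernelVec G B x)) := by
                refine lintegral_mono fun x => ?_
                rw [← ENNReal.ofReal_mul (by positivity), hsmul]
                refine ENNReal.ofReal_le_ofReal ((exp_sub_one_le_mul_exp _).trans ?_)
                have h1 : |s| * p (kernelVec G B x) ≤ c * p (kernelVec G B x) := by
                  gcongr
                  exact hpos _
                have h2 : c * p (kernelVec G B x) ≤ c * M := by
                  gcongr
                  exact hM x
                calc |s| * p (kernelVec G B x) * Real.exp (|s| * p (kernelVec G B x))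
                    ≤ (c * p (kernelVec G B x)) * Real.exp (c * M) := 
                      mul_le_mul h1 (Real.exp_le_exp.2 (h1.trans h2)) (Real.exp_pos _).le
                        (mul_nonneg hc (hpos _))
                  _ = _ := by ring
            _ ≤ ENNReal.ofReal (c * Real.exp (c * M)) * ENNReal.ofReal K := by
                rw [lintegral_const_mul _ (by fun_prop)]
                gcongr
            _ = _ := by
                rw [← ENNReal.ofReal_mul (by positivity)]
                ring_nf
      _ = ENNReal.ofReal (z * c * K * Real.exp (c * M)) := by
          rw [lintegral_const, Measure.smul_apply, measure_univ, smul_eq_mul, mul_one, mul_comm,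
            ← ENNReal.ofReal_mul hz]
          ring_nf

/-- The field extends to a bounded operator from `L¹(dx)` to `L¹(P)`. -/
theorem lintegral_abs_eval_le (hGm : Measurable G) (hG : Integrable G volume) (hz : 0 ≤ z)
    (hc : 0 ≤ c) (hr : ∀ᵐ s ∂r, |s| ≤ c)
    (hX : ∀ f : 𝓢(Space d, ℝ), ∫ ω, Complex.exp (Complex.I * (ω f : ℂ)) ∂PX
      = Complex.exp (∫ x, poissonCharacteristic z r (transposeConv G f x)))
    (f : 𝓢(Space d, ℝ)) :
    ∫⁻ ω, ‖ω f‖ₑ ∂PX ≤ ENNReal.ofReal (z * c) * ∫⁻ x, ‖transposeConv G f x‖ₑ := by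
  obtain ⟨C, hC0, hC⟩ := exists_bound_schwartz f
  set M : ℝ := C * ∫ y, ‖G y‖ with hM
  set K : ℝ := ∫ x, ‖transposeConv G f x‖ with hKdef
  have hM0 : 0 ≤ M := by positivity
  have hK0 : 0 ≤ K := by positivity
  have hfm : Measurable fun ω : Tempered d => ω f := (WeakDual.eval_continuous f).measurable
  have hint := integrable_transposeConv hGm hG f
  have hKe : ∫⁻ x, ‖transposeConv G f x‖ₑ = ENNReal.ofReal K := by
    rw [hKdef, ofReal_integral_norm_eq_lintegral_enorm hint]
  -- the exponential moment bound for `δ |ω f|`, whose derivative at `δ = 0` is the claim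
  have hδ : ∀ δ : ℝ, 0 < δ → ∫⁻ ω, ‖ω f‖ₑ ∂PX ≤ ENNReal.ofReal
      (δ⁻¹ * (Real.exp (z * c * (δ * K) * Real.exp (c * (δ * M))) - Real.exp 0)) := by
    intro δ hδ
    have h1 := lintegral_exp_evalVec_le (ι := Unit) hGm hG hz hc hr hX (fun _ => f)
      (p := fun y => δ * |y ()|) (by fun_prop)
      (fun x y => by
        rw [← mul_add]
        exact mul_le_mul_of_nonneg_left (abs_add_le _ _) hδ.le)
      (fun x => by positivity) (fun s x => by simp [abs_mul]; ring) (M := δ * M) (K := δ * K)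
      (by positivity)
      (fun x => mul_le_mul_of_nonneg_left (abs_transposeConv_le hG hC x) hδ.le)
      (by
        simp only [kernelVec, ENNReal.ofReal_mul hδ.le]
        rw [lintegral_const_mul' _ _ ENNReal.ofReal_ne_top, ← hKe]
        simp [Real.enorm_eq_ofReal_abs])
    have h2 : ∀ ω : Tempered d, ENNReal.ofReal δ * ‖ω f‖ₑ + 1
        ≤ ENNReal.ofReal (Real.exp (δ * |ω f|)) := by
      intro ω
      rw [Real.enorm_eq_ofReal_abs, ← ENNReal.ofReal_mul hδ.le, ← ENNReal.ofReal_one,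
        ← ENNReal.ofReal_add (by positivity) zero_le_one]
      exact ENNReal.ofReal_le_ofReal (Real.add_one_le_exp _)
    have h3 := (lintegral_mono h2).trans h1
    rw [lintegral_add_right _ measurable_const, lintegral_one, measure_univ,
      lintegral_const_mul _ hfm.enorm] at h3
    have h4 : ENNReal.ofReal δ * ∫⁻ ω, ‖ω f‖ₑ ∂PX ≤ ENNReal.ofReal
        (Real.exp (z * c * (δ * K) * Real.exp (c * (δ * M))) - Real.exp 0) := by
      rw [Real.exp_zero, ENNReal.ofReal_sub _ zero_le_one, ENNReal.ofReal_one]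
      exact ENNReal.le_sub_of_add_le_right ENNReal.one_ne_top h3
    rw [ENNReal.ofReal_mul (by positivity), ENNReal.ofReal_inv_of_pos hδ,
      ← ENNReal.div_eq_inv_mul]
    rw [ENNReal.le_div_iff_mul_le (Or.inl (by simpa using hδ)) (Or.inl ENNReal.ofReal_ne_top)]
    rwa [mul_comm]
  have hder : HasDerivAt (fun δ : ℝ => Real.exp (z * c * (δ * K) * Real.exp (c * (δ * M))))
      (z * c * K) 0 := by
    have hu : HasDerivAt (fun δ : ℝ => z * c * (δ * K)) (z * c * K) 0 := by
      simpa using ((hasDerivAt_id (0 : ℝ)).mul_const K).const_mul (z * c)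
    have hv : HasDerivAt (fun δ : ℝ => Real.exp (c * (δ * M))) (c * M) 0 := by
      simpa using (((hasDerivAt_id (0 : ℝ)).mul_const M).const_mul c).exp
    simpa using (hu.mul hv).exp
  have hslope := hder.tendsto_slope_zero_right
  simp only [zero_add, zero_mul, mul_zero, smul_eq_mul] at hslope
  rw [hKe, ← ENNReal.ofReal_mul (by positivity)]
  refine ge_of_tendsto (ENNReal.tendsto_ofReal hslope) ?_
  filter_upwards [self_mem_nhdsWithin] with δ hδ0
  exact hδ δ hδ0

end Moments

/-! ### Continuity of translations in `L¹` -/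

section Translation

variable {d : ℕ} {G : Space d → ℝ}

/-- Translations act continuously on `L¹`. -/
lemma tendsto_lintegral_translate_sub (hG : Integrable G volume) :
    Tendsto (fun h : Space d => ∫⁻ u, ‖G (h + u) - G u‖ₑ) (𝓝 0) (𝓝 0) := by
  have hfact : Fact ((1 : ℝ≥0∞) ≠ ∞) := ⟨ENNReal.one_ne_top⟩
  let g : Lp ℝ 1 (volume : Measure (Space d)) := hG.toL1 G
  have hcont : Continuous fun h : Space d => (DomAddAct.mk h) +ᵥ g := by
    have h1 : Continuous fun h : Space d => DomAddAct.mk h := DomAddAct.continuous_mk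
    exact h1.vadd continuous_const
  have hlim : Tendsto (fun h : Space d => edist ((DomAddAct.mk h) +ᵥ g) g) (𝓝 0) (𝓝 0) := by
    have := (hcont.edist continuous_const : Continuous fun h : Space d =>
      edist ((DomAddAct.mk h) +ᵥ g) g).tendsto 0
    simpa using this
  refine hlim.congr fun h => ?_
  rw [Lp.edist_def, eLpNorm_one_eq_lintegral_enorm]
  refine lintegral_congr_ae ?_
  have h1 : ⇑((DomAddAct.mk h) +ᵥ g) =ᵐ[volume] fun u => g (h + u) :=
    DomAddAct.vadd_Lp_ae_eq (DomAddAct.mk h) g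
  have h2 : g =ᵐ[volume] G := hG.coeFn_toL1
  have h3 := (measurePreserving_add_left volume h).quasiMeasurePreserving.ae h2
  filter_upwards [h1, h2, h3] with u hu1 hu2 hu3
  simp only [Pi.sub_apply]
  rw [hu1, hu2, hu3]

lemma exists_translate_modulus (hG : Integrable G volume) :
    ∃ η : ℕ → ℝ≥0∞, Tendsto η atTop (𝓝 0) ∧ ∀ (n : ℕ) (h : Space d), ‖h‖ ≤ 3 / (n + 1) →
      ∫⁻ u, ‖G (h + u) - G u‖ₑ ≤ η n := by
  refine ⟨fun n => ⨆ (h : Space d) (_ : ‖h‖ ≤ 3 / (n + 1)), ∫⁻ u, ‖G (h + u) - G u‖ₑ, ?_,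
    fun n h hh => le_iSup₂ (f := fun (h : Space d) (_ : ‖h‖ ≤ 3 / (n + 1)) =>
      ∫⁻ u, ‖G (h + u) - G u‖ₑ) h hh⟩
  rw [ENNReal.tendsto_nhds_zero]
  intro ε hε
  have h1 := ENNReal.tendsto_nhds_zero.1 (tendsto_lintegral_translate_sub hG) ε hε
  obtain ⟨δ, hδ, hball⟩ := Metric.eventually_nhds_iff.1 h1
  have h2 : Tendsto (fun n : ℕ => 3 * (1 / ((n : ℝ) + 1))) atTop (𝓝 (3 * 0)) :=
    tendsto_one_div_add_atTop_nhds_zero_nat.const_mul 3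
  rw [mul_zero] at h2
  filter_upwards [h2.eventually_lt_const hδ] with n hn
  refine iSup₂_le fun h hh => hball ?_
  rw [dist_zero_right]
  refine hh.trans_lt ?_
  rwa [mul_one_div] at hn

end Translation

/-! ### Finite families of concentrating densities -/

section Probe

/-- A finite family of probability densities in `𝓢`, with a measurable choice `index` of one
member for each point of space, such that on the ball of radius `n` the member chosen at `x` is
supported within `3 / (n + 1)` of `x`, and the members are not too concentrated: their average
over the ball of radius `n` is bounded by `3 ^ d`. -/
structure ProbeFamily (d n : ℕ) where
  /-- one less than the number of members -/
  last : ℕ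
  /-- the member attached to a point of space -/
  index : Space d → Fin (last + 1)
  measurable_index : Measurable index
  /-- the members -/
  density : Fin (last + 1) → 𝓢(Space d, ℝ)
  integral_density : ∀ i, ∫ w, density i w = 1
  lintegral_density : ∀ i, ∫⁻ w, ‖density i w‖ₑ = 1
  norm_sub_le : ∀ x w : Space d, ‖x‖ ≤ n → density (index x) w ≠ 0 → ‖w - x‖ ≤ 3 / (n + 1)
  average_le : ∀ w : Space d,
    ∫⁻ x in Metric.closedBall 0 (n : ℝ), ‖density (index x) w‖ₑ ≤ 3 ^ d

/-- A finite net of the ball of radius `n`, with a measurable nearest-point map. -/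
lemma exists_measurable_net (d n : ℕ) {ρ : ℝ} (hρ : 0 < ρ) :
    ∃ (N : ℕ) (a : Fin (N + 1) → Space d) (j : Space d → Fin (N + 1)), Measurable j ∧
      ∀ x, ‖x‖ ≤ n → dist (a (j x)) x ≤ ρ := by
  let e : ℕ → Space d := TopologicalSpace.denseSeq (Space d)
  have hcover : Metric.closedBall (0 : Space d) n ⊆ ⋃ i, Metric.ball (e i) ρ := by
    intro x _
    obtain ⟨i, hi⟩ := (TopologicalSpace.denseRange_denseSeq (Space d)).exists_dist_lt x hρ
    exact Set.mem_iUnion.2 ⟨i, hi⟩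
  obtain ⟨t, ht⟩ := (isCompact_closedBall (0 : Space d) n).elim_finite_subcover _
    (fun i => Metric.isOpen_ball) hcover
  obtain ⟨N, hN⟩ := t.exists_nat_subset_range
  refine ⟨N, fun i => e i, fun x => ⟨SimpleFunc.nearestPtInd e N x,
    Nat.lt_succ_of_le (SimpleFunc.nearestPtInd_le e N x)⟩, ?_, fun x hx => ?_⟩
  · refine measurable_to_countable' fun i => ?_
    have := SimpleFunc.measurableSet_fiber (SimpleFunc.nearestPtInd e N) (i : ℕ)
    convert this using 1
    ext x
    simp [Fin.ext_iff]
  · obtain ⟨i, hi, hxi⟩ : ∃ i ∈ t, x ∈ Metric.ball (e i) ρ := by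
      simpa using ht (by simpa using hx : x ∈ Metric.closedBall (0 : Space d) n)
    have h1 := SimpleFunc.edist_nearestPt_le e x (Finset.mem_range.1 (hN hi)).le
    have h2 : SimpleFunc.nearestPt e N x = e (SimpleFunc.nearestPtInd e N x) := rfl
    rw [h2, edist_dist, edist_dist, ENNReal.ofReal_le_ofReal_iff dist_nonneg] at h1
    exact h1.trans (by rw [dist_comm]; exact (Metric.mem_ball.1 hxi).le)

theorem nonempty_probeFamily (d n : ℕ) : Nonempty (ProbeFamily d n) := by
  set ρ : ℝ := 1 / (n + 1) with hρdef
  have hρ : 0 < ρ := by positivity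
  obtain ⟨N, a, j, hj, hdist⟩ := exists_measurable_net d n hρ
  -- bumps of radius comparable to the mesh, so that their average over the points stays bounded
  let b : ∀ i, ContDiffBump (a i) := fun i => ⟨ρ, 2 * ρ, hρ, by linarith⟩
  let B : Fin (N + 1) → 𝓢(Space d, ℝ) := fun i =>
    HasCompactSupport.toSchwartzMap ((b i).hasCompactSupport_normed (μ := volume))
      (b i).contDiff_normed
  have hB : ∀ i w, B i w = (b i).normed volume w := fun i w => rfl
  have hBpos : ∀ i w, 0 ≤ B i w := fun i w => (b i).nonneg_normed w
  have hBint : ∀ i, ∫ w, B i w = 1 := fun i => (b i).integral_normed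
  have hclose : ∀ x w : Space d, ‖x‖ ≤ n → B (j x) w ≠ 0 → ‖w - x‖ ≤ 3 * ρ := by
    intro x w hx hw
    have h1 : w ∈ Function.support ((b (j x)).normed volume) := hw
    rw [(b (j x)).support_normed_eq, Metric.mem_ball] at h1
    have h2 := hdist x hx
    have h3 := dist_triangle w (a (j x)) x
    have h4 : dist w (a (j x)) < 2 * ρ := h1
    rw [← dist_eq_norm]
    linarith
  refine ⟨⟨N, j, hj, B, hBint, fun i => ?_, fun x w hx hw => ?_, fun w => ?_⟩⟩
  · simp_rw [Real.enorm_eq_ofReal (hBpos i _)]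
    rw [← ofReal_integral_eq_lintegral_ofReal (B i).integrable (ae_of_all _ (hBpos i)), hBint]
    simp
  · have := hclose x w hx hw
    rwa [hρdef, mul_one_div] at this
  · set V : ℝ≥0∞ := volume (Metric.closedBall (0 : Space d) ρ) with hV
    have hV0 : V ≠ 0 := (Metric.measure_closedBall_pos _ _ hρ).ne'
    have hVt : V ≠ ∞ := measure_closedBall_lt_top.ne
    -- the density is at most `V⁻¹`, and only points within three radii of `w` contribute: `3 ^ d`
    -- is the ratio of the volumes of the two balls
    have hle : ∀ i w, ‖B i w‖ₑ ≤ V⁻¹ := by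
      intro i w
      have h1 := (b i).normed_le_div_measure_closedBall_rIn (μ := volume) w
      rw [Measure.addHaar_real_closedBall_center] at h1
      rw [Real.enorm_eq_ofReal (hBpos i w), hB]
      refine (ENNReal.ofReal_le_ofReal h1).trans_eq ?_
      have h2 : (b i).rIn = ρ := rfl
      have h3 : 0 < volume.real (Metric.closedBall (0 : Space d) ρ) := ENNReal.toReal_pos hV0 hVt
      rw [h2, one_div, ENNReal.ofReal_inv_of_pos h3, ofReal_measureReal hVt]
    calc ∫⁻ x in Metric.closedBall 0 (n : ℝ), ‖B (j x) w‖ₑ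
        ≤ ∫⁻ x in Metric.closedBall 0 (n : ℝ),
            (Metric.closedBall w (3 * ρ)).indicator (fun _ => V⁻¹) x := by
          refine setLIntegral_mono_ae' measurableSet_closedBall (ae_of_all _ fun x hx => ?_)
          by_cases h : B (j x) w = 0
          · simp [h]
          · have := hclose x w (by simpa using hx) h
            rw [Set.indicator_of_mem (by rwa [Metric.mem_closedBall, dist_comm, dist_eq_norm])]
            exact hle _ _
      _ ≤ ∫⁻ x, (Metric.closedBall w (3 * ρ)).indicator (fun _ => V⁻¹) x :=
          setLIntegral_le_lintegral _ _
      _ = 3 ^ d := by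
          rw [lintegral_indicator measurableSet_closedBall, setLIntegral_const,
            Measure.addHaar_closedBall_mul _ _ (by norm_num) hρ.le, ← hV, mul_comm, mul_assoc,
            ENNReal.mul_inv_cancel hV0 hVt, mul_one]
          simp [ENNReal.ofReal_pow]

/-- A choice of probe families. -/
def probe (d n : ℕ) : ProbeFamily d n := (nonempty_probeFamily d n).some

variable {d : ℕ} {G : Space d → ℝ}

/-- The kernel of the field smeared with the probe at `x` is close in `L¹` to the kernel
`y ↦ G (x - y)` of the field at the point `x`. -/
lemma lintegral_transposeConv_probe_sub_le (hGm : Measurable G) (hG : Integrable G volume) {n : ℕ}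
    {η : ℝ≥0∞} (hη : ∀ h : Space d, ‖h‖ ≤ 3 / (n + 1) → ∫⁻ u, ‖G (h + u) - G u‖ₑ ≤ η)
    (Q : ProbeFamily d n) {x : Space d} (hx : ‖x‖ ≤ n) :
    ∫⁻ y, ‖transposeConv G (Q.density (Q.index x)) y - G (x - y)‖ₑ ≤ η := by
  set f := Q.density (Q.index x) with hf
  have hfm := f.continuous.measurable
  calc ∫⁻ y, ‖transposeConv G f y - G (x - y)‖ₑ
      ≤ ∫⁻ y, ∫⁻ w, ‖G (w - y) - G (x - y)‖ₑ * ‖f w‖ₑ := by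
        refine lintegral_mono fun y => ?_
        have : transposeConv G f y - G (x - y) = ∫ w, (G (w - y) - G (x - y)) * f w := by
          simp_rw [sub_mul]
          rw [integral_sub (integrable_comp_sub_mul hG f y) (f.integrable.const_mul _),
            integral_const_mul, hf, Q.integral_density, mul_one]
          rfl
        rw [this]
        refine (enorm_integral_le_lintegral_enorm _).trans_eq ?_
        simp
    _ = ∫⁻ w, ∫⁻ y, ‖G (w - y) - G (x - y)‖ₑ * ‖f w‖ₑ := by
        refine lintegral_lintegral_swap (Measurable.aemeasurable ?_)
        unfold Function.uncurry
        fun_prop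
    _ ≤ ∫⁻ w, η * ‖f w‖ₑ := by
        refine lintegral_mono fun w => ?_
        simp only
        rw [lintegral_mul_const _ (by fun_prop)]
        by_cases hw : f w = 0
        · simp [hw]
        · gcongr
          refine le_trans (le_of_eq ?_) (hη (w - x) (Q.norm_sub_le x w hx hw))
          rw [← lintegral_sub_left_eq_self (fun u => ‖G (w - x + u) - G u‖ₑ) x]
          simp
    _ = η := by
        rw [lintegral_const_mul _ (by fun_prop), hf, Q.lintegral_density, mul_one]

lemma lintegral_transposeConv_probe_sub_le_two_mul (hGm : Measurable G) {n : ℕ}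
    (Q : ProbeFamily d n) (x : Space d) :
    ∫⁻ y, ‖transposeConv G (Q.density (Q.index x)) y - G (x - y)‖ₑ ≤ 2 * ∫⁻ y, ‖G y‖ₑ := by
  have hm := measurable_transposeConv hGm (Q.density (Q.index x))
  calc ∫⁻ y, ‖transposeConv G (Q.density (Q.index x)) y - G (x - y)‖ₑ
      ≤ ∫⁻ y, (‖transposeConv G (Q.density (Q.index x)) y‖ₑ + ‖G (x - y)‖ₑ) :=
        lintegral_mono fun y => enorm_sub_le
    _ = (∫⁻ y, ‖transposeConv G (Q.density (Q.index x)) y‖ₑ) + ∫⁻ y, ‖G y‖ₑ := by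
        rw [lintegral_add_left (by fun_prop), lintegral_sub_left_eq_self (fun u => ‖G u‖ₑ) x]
    _ ≤ (∫⁻ y, ‖G y‖ₑ) * 1 + ∫⁻ y, ‖G y‖ₑ := by
        gcongr
        exact (lintegral_transposeConv_le hGm _).trans_eq (by rw [Q.lintegral_density])
    _ = _ := by ring

end Probe

/-! ### Separability of the Schwartz space -/

section Separability

variable {E : Type*} [NormedAddCommGroup E] [NormedSpace ℝ E]

/-- All derivatives of a Schwartz function, as continuous functions. -/
def derivFamily (f : 𝓢(E, ℝ)) (l : ℕ) : C(E, E [×l]→L[ℝ] ℝ) :=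
  ⟨iteratedFDeriv ℝ l f, (f.smooth l).continuous_iteratedFDeriv le_rfl⟩

/-- Locally uniform closeness of finitely many derivatives upgrades to closeness in finitely many
Schwartz seminorms on sets on which the seminorms with one more power of `‖x‖` are bounded. -/
lemma seminorm_sub_le_of_close {f g : 𝓢(E, ℝ)} {k l n : ℕ} {M R δ : ℝ} (hR : 1 ≤ R) (hδ : 0 ≤ δ)
    (hk : k ≤ n) (hf : SchwartzMap.seminorm ℝ (k + 1) l f ≤ M)
    (hg : SchwartzMap.seminorm ℝ (k + 1) l g ≤ M)
    (hfg : ∀ x, ‖x‖ ≤ R → ‖iteratedFDeriv ℝ l f x - iteratedFDeriv ℝ l g x‖ ≤ δ) :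
    SchwartzMap.seminorm ℝ k l (g - f) ≤ max (R ^ n * δ) (2 * M / R) := by
  have hR0 : 0 < R := by linarith
  refine SchwartzMap.seminorm_le_bound ℝ k l _ (le_max_of_le_left (by positivity)) fun x => ?_
  have hsub : iteratedFDeriv ℝ l (g - f) x = iteratedFDeriv ℝ l g x - iteratedFDeriv ℝ l f x :=
    iteratedFDeriv_sub_apply ((g.smooth l).contDiffAt) ((f.smooth l).contDiffAt)
  rcases le_or_gt ‖x‖ R with hx | hx
  · refine le_max_of_le_left ?_
    have h1 := hfg x hx
    rw [norm_sub_rev, ← hsub] at h1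
    calc ‖x‖ ^ k * ‖iteratedFDeriv ℝ l (g - f) x‖ ≤ R ^ k * δ := by gcongr
      _ ≤ R ^ n * δ := by gcongr
  · refine le_max_of_le_right ?_
    have h1 := SchwartzMap.le_seminorm ℝ (k + 1) l (g - f) x
    have h2 := map_sub_le_add (SchwartzMap.seminorm ℝ (k + 1) l) g f
    rw [le_div_iff₀ hR0]
    calc ‖x‖ ^ k * ‖iteratedFDeriv ℝ l (g - f) x‖ * R
        ≤ ‖x‖ ^ k * ‖iteratedFDeriv ℝ l (g - f) x‖ * ‖x‖ := by gcongr
      _ = ‖x‖ ^ (k + 1) * ‖iteratedFDeriv ℝ l (g - f) x‖ := by ring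
      _ ≤ 2 * M := by linarith

variable [FiniteDimensional ℝ E]

lemma secondCountableTopology_continuousMultilinearMap (l : ℕ) :
    SecondCountableTopology (E [×l]→L[ℝ] ℝ) := by
  have : Module.Finite ℝ (E [×l]→L[ℝ] ℝ) :=
    Module.Finite.of_injective (ContinuousMultilinearMap.toMultilinearMapLinear (R' := ℝ) (A := ℝ)
        (M₁ := fun _ : Fin l => E) (M₂ := ℝ))
      ContinuousMultilinearMap.toMultilinearMap_injective
  have : ProperSpace (E [×l]→L[ℝ] ℝ) := FiniteDimensional.proper_rclike ℝ _
  infer_instance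

/-- The space of Schwartz functions is separable. -/
theorem exists_countable_dense_schwartz : ∃ D : Set 𝓢(E, ℝ), D.Countable ∧ Dense D := by
  have hsc : ∀ l, SecondCountableTopology (E [×l]→L[ℝ] ℝ) :=
    secondCountableTopology_continuousMultilinearMap
  have : ProperSpace E := FiniteDimensional.proper_rclike ℝ E
  -- the sets on which finitely many seminorms are bounded by an integer
  let S : ℕ → ℕ → Set 𝓢(E, ℝ) := fun n M =>
    {f | ∀ k ≤ n, ∀ l ≤ n, SchwartzMap.seminorm ℝ (k + 1) l f ≤ M}
  have hdense : ∀ n M, ∃ D ⊆ S n M, D.Countable ∧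
      derivFamily '' S n M ⊆ closure (derivFamily '' D) := by
    intro n M
    obtain ⟨t, htc, htd⟩ := TopologicalSpace.exists_countable_dense ↥(derivFamily '' S n M)
    rw [Subtype.dense_iff] at htd
    have hsub : ((↑) '' t : Set (∀ l, C(E, E [×l]→L[ℝ] ℝ))) ⊆ derivFamily '' S n M := by
      rintro _ ⟨y, -, rfl⟩
      exact y.2
    choose! F hFS hF using fun y (hy : y ∈ ((↑) '' t : Set (∀ l, C(E, E [×l]→L[ℝ] ℝ)))) => hsub hy
    refine ⟨F '' ((↑) '' t), ?_, (htc.image _).image _, fun y hy => ?_⟩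
    · rintro _ ⟨y, hy, rfl⟩
      exact hFS y hy
    · convert htd hy using 2
      rw [Set.image_image]
      exact (Set.image_congr hF).trans (Set.image_id' _)
  choose D hDS hDc hD using hdense
  refine ⟨⋃ n, ⋃ M, D n M, Set.countable_iUnion fun n => Set.countable_iUnion fun M => hDc n M,
    fun f => mem_closure_iff_nhds.2 fun U hU => ?_⟩
  obtain ⟨s, ε, hε, hball⟩ := ((schwartz_withSeminorms ℝ E ℝ).mem_nhds_iff f U).1 hU
  obtain ⟨n, hn⟩ : ∃ n : ℕ, ∀ i ∈ s, i.1 ≤ n ∧ i.2 ≤ n :=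
    ⟨s.sup fun i => max i.1 i.2, fun i hi => by
      have := Finset.le_sup (f := fun i : ℕ × ℕ => max i.1 i.2) hi
      exact ⟨(le_max_left _ _).trans this, (le_max_right _ _).trans this⟩⟩
  obtain ⟨M, hM⟩ : ∃ M : ℕ, ∀ k ≤ n, ∀ l ≤ n, SchwartzMap.seminorm ℝ (k + 1) l f ≤ M := by
    obtain ⟨M, hM⟩ := exists_nat_ge (∑ k ∈ Finset.range (n + 1), ∑ l ∈ Finset.range (n + 1),
      SchwartzMap.seminorm ℝ (k + 1) l f)
    refine ⟨M, fun k hk l hl => le_trans ?_ hM⟩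
    calc SchwartzMap.seminorm ℝ (k + 1) l f
        ≤ ∑ l ∈ Finset.range (n + 1), SchwartzMap.seminorm ℝ (k + 1) l f :=
          Finset.single_le_sum (f := fun l => SchwartzMap.seminorm ℝ (k + 1) l f)
            (fun _ _ => apply_nonneg _ _) (Finset.mem_range.2 (by omega))
      _ ≤ _ := Finset.single_le_sum (f := fun k => ∑ l ∈ Finset.range (n + 1),
          SchwartzMap.seminorm ℝ (k + 1) l f)
            (fun _ _ => Finset.sum_nonneg fun _ _ => apply_nonneg _ _)
            (Finset.mem_range.2 (by omega))
  set R : ℝ := max 1 (8 * M / ε) with hRdef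
  have hR1 : 1 ≤ R := le_max_left _ _
  set δ : ℝ := ε / 2 / R ^ n with hδdef
  have hδ : 0 < δ := by positivity
  have hnear : ∀ᶠ y in 𝓝 (derivFamily f), ∀ l ∈ Finset.range (n + 1),
      ∀ x ∈ Metric.closedBall (0 : E) R, dist (derivFamily f l x) (y l x) < δ := by
    rw [Filter.eventually_all_finset]
    intro l _
    have h1 := (ContinuousMap.tendsto_iff_forall_isCompact_tendstoUniformlyOn.1
      (tendsto_id (x := 𝓝 (derivFamily f l)))) _ (isCompact_closedBall (0 : E) R)
    exact ((continuous_apply l).tendsto (derivFamily f)).eventually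
      (Metric.tendstoUniformlyOn_iff.1 h1 δ hδ)
  have hmem : derivFamily f ∈ closure (derivFamily '' D n M) := hD n M ⟨f, hM, rfl⟩
  obtain ⟨_, ⟨g, hgD, rfl⟩, hg⟩ :=
    ((mem_closure_iff_frequently.1 hmem).and_eventually hnear).exists
  refine ⟨g, hball ?_, Set.mem_iUnion.2 ⟨n, Set.mem_iUnion.2 ⟨M, hgD⟩⟩⟩
  rw [Seminorm.mem_ball]
  refine Seminorm.finset_sup_apply_lt hε fun i hi => ?_
  obtain ⟨hi1, hi2⟩ := hn i hi
  refine (seminorm_sub_le_of_close (n := n) (M := M) (R := R) (δ := δ) hR1 hδ.le hi1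
    (hM _ hi1 _ hi2) (hDS n M hgD _ hi1 _ hi2) fun x hx => ?_).trans_lt (max_lt ?_ ?_)
  · have := hg i.2 (Finset.mem_range.2 (by omega)) x (by simpa using hx)
    rw [dist_eq_norm] at this
    exact this.le
  · rw [hδdef, mul_div_cancel₀ _ (by positivity)]
    linarith
  · rw [div_lt_iff₀ (by linarith)]
    have h1 : 8 * M / ε ≤ R := le_max_right _ _
    rw [div_le_iff₀ hε] at h1
    nlinarith [mul_pos hε (by linarith : 0 < R)]

end Separability

/-! ### The weighted space `L¹(g_ε dx)` inside `𝓢'` -/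

section Weight

variable {d : ℕ} {ε : ℝ}

lemma one_le_one_add_norm_sq (x : Space d) : 1 ≤ 1 + ‖x‖ ^ 2 := by
  nlinarith [sq_nonneg ‖x‖]

lemma weight_pos (x : Space d) : 0 < weight d ε x := by
  have := one_le_one_add_norm_sq x
  unfold weight
  positivity

lemma continuous_weight : Continuous (weight d ε) := by
  unfold weight
  refine continuous_const.div ?_ fun x => ?_
  · exact Continuous.rpow_const (by fun_prop) fun x =>
      Or.inl (by linarith [one_le_one_add_norm_sq x])
  · have := one_le_one_add_norm_sq x
    positivity

lemma integrable_weight (hε : 0 < ε) : Integrable (weight d ε) volume := by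
  have h := integrable_rpow_neg_one_add_norm_sq (E := Space d) (μ := volume) (r := d + ε)
    (by simpa using hε)
  refine h.congr (ae_of_all _ fun x => ?_)
  have := one_le_one_add_norm_sq x
  simp only [weight]
  rw [neg_div, Real.rpow_neg (by positivity), one_div]

lemma isFiniteMeasure_weightedVolume (hε : 0 < ε) : IsFiniteMeasure (weightedVolume d ε) :=
  isFiniteMeasure_withDensity_ofReal (integrable_weight hε).2

instance sFinite_weightedVolume : SFinite (weightedVolume d ε) := by
  unfold weightedVolume
  infer_instance

lemma measurable_ofReal_weight : Measurable fun x : Space d => ENNReal.ofReal (weight d ε x) := by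
  have := (continuous_weight (d := d) (ε := ε)).measurable
  fun_prop

lemma weightedVolume_absolutelyContinuous : weightedVolume d ε ≪ volume :=
  withDensity_absolutelyContinuous _ _

lemma absolutelyContinuous_weightedVolume : volume ≪ weightedVolume d ε :=
  withDensity_absolutelyContinuous' measurable_ofReal_weight.aemeasurable
    (ae_of_all _ fun x => by simp [weight_pos])

lemma lintegral_weightedVolume (g : Space d → ℝ≥0∞) :
    ∫⁻ x, g x ∂(weightedVolume d ε) = ∫⁻ x, ENNReal.ofReal (weight d ε x) * g x :=
  lintegral_withDensity_eq_lintegral_mul_non_measurable _ measurable_ofReal_weight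
    (ae_of_all _ fun _ => ENNReal.ofReal_lt_top) g

lemma integrable_weightedVolume_iff {u : Space d → ℝ} :
    Integrable u (weightedVolume d ε) ↔ Integrable (fun x => weight d ε x * u x) volume := by
  rw [weightedVolume, integrable_withDensity_iff_integrable_smul' measurable_ofReal_weight
    (ae_of_all _ fun _ => ENNReal.ofReal_lt_top)]
  simp only [ENNReal.toReal_ofReal (weight_pos _).le, smul_eq_mul]

lemma integral_weightedVolume (u : Space d → ℝ) :
    ∫ x, u x ∂(weightedVolume d ε) = ∫ x, weight d ε x * u x := by
  rw [weightedVolume, integral_withDensity_eq_integral_toReal_smul measurable_ofReal_weight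
    (ae_of_all _ fun _ => ENNReal.ofReal_lt_top)]
  simp only [ENNReal.toReal_ofReal (weight_pos _).le, smul_eq_mul]

/-- Schwartz functions are dominated by the weight, with a constant controlled by a continuous
seminorm. -/
lemma exists_schwartz_le_weight (d : ℕ) (ε : ℝ) : ∃ (s : Finset (ℕ × ℕ)) (C : ℝ), 0 ≤ C ∧
    ∀ (f : 𝓢(Space d, ℝ)) (x : Space d),
      |f x| ≤ C * s.sup (schwartzSeminormFamily ℝ (Space d) ℝ) f * weight d ε x := by
  obtain ⟨k, hk⟩ := exists_nat_ge (max 0 ((d : ℝ) + ε))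
  refine ⟨Finset.Iic (k, 0), 2 ^ k, by positivity, fun f x => ?_⟩
  have h1 := SchwartzMap.one_add_le_sup_seminorm_apply (𝕜 := ℝ) (m := (k, 0)) (k := k) (n := 0)
    le_rfl le_rfl f x
  rw [norm_iteratedFDeriv_zero] at h1
  have h0 := one_le_one_add_norm_sq x
  have h2 : (1 + ‖x‖ ^ 2) ^ (((d : ℝ) + ε) / 2) ≤ (1 + ‖x‖) ^ k := by
    calc (1 + ‖x‖ ^ 2) ^ (((d : ℝ) + ε) / 2) ≤ (1 + ‖x‖ ^ 2) ^ ((k : ℝ) / 2) := by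
          refine Real.rpow_le_rpow_of_exponent_le h0 ?_
          have := (le_max_right _ _).trans hk
          linarith
      _ ≤ ((1 + ‖x‖) ^ 2) ^ ((k : ℝ) / 2) := by
          refine Real.rpow_le_rpow (by positivity) ?_ (by positivity)
          nlinarith [norm_nonneg x]
      _ = (1 + ‖x‖) ^ k := by
          rw [← Real.rpow_natCast (1 + ‖x‖) 2, ← Real.rpow_mul (by positivity),
            ← Real.rpow_natCast]
          congr 1
          push_cast
          ring
  rw [weight, mul_one_div, le_div_iff₀ (by positivity)]
  calc |f x| * (1 + ‖x‖ ^ 2) ^ (((d : ℝ) + ε) / 2) ≤ |f x| * (1 + ‖x‖) ^ k := by gcongr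
    _ = (1 + ‖x‖) ^ k * ‖f x‖ := by rw [mul_comm, Real.norm_eq_abs]
    _ ≤ _ := h1

lemma exists_bound_weight (f : 𝓢(Space d, ℝ)) (ε : ℝ) :
    ∃ C, 0 ≤ C ∧ ∀ x, |f x| ≤ C * weight d ε x := by
  obtain ⟨s, C, hC, h⟩ := exists_schwartz_le_weight d ε
  exact ⟨_, mul_nonneg hC (apply_nonneg _ _), h f⟩

lemma aestronglyMeasurable_of_weighted {u : Space d → ℝ}
    (hu : Integrable u (weightedVolume d ε)) : AEStronglyMeasurable u volume :=
  hu.1.mono_ac absolutelyContinuous_weightedVolume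

lemma integrable_mul_of_le_weight {u : Space d → ℝ}
    (hu : Integrable u (weightedVolume d ε)) {f : Space d → ℝ}
    (hf : AEStronglyMeasurable f volume) {C : ℝ}
    (hC : ∀ x, |f x| ≤ C * weight d ε x) : Integrable (fun x => u x * f x) volume := by
  refine ((integrable_weightedVolume_iff.1 hu).norm.const_mul C).mono'
    ((aestronglyMeasurable_of_weighted hu).mul hf) (ae_of_all _ fun x => ?_)
  rw [norm_mul, norm_mul, Real.norm_of_nonneg (weight_pos x).le]
  calc ‖u x‖ * ‖f x‖ ≤ ‖u x‖ * (C * weight d ε x) := by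
        gcongr
        exact hC x
    _ = _ := by ring

lemma integrable_mul_schwartz {u : Space d → ℝ}
    (hu : Integrable u (weightedVolume d ε)) (f : 𝓢(Space d, ℝ)) :
    Integrable (fun x => u x * f x) volume := by
  obtain ⟨C, -, hC⟩ := exists_bound_weight f ε
  exact integrable_mul_of_le_weight hu f.continuous.aestronglyMeasurable hC

lemma abs_integral_mul_le {u : Space d → ℝ}
    (hu : Integrable u (weightedVolume d ε)) {f : Space d → ℝ}
    (hf : AEStronglyMeasurable f volume) {C : ℝ}
    (hC : ∀ x, |f x| ≤ C * weight d ε x) :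
    |∫ x, u x * f x| ≤ C * ∫ x, ‖u x‖ ∂(weightedVolume d ε) := by
  rw [integral_weightedVolume, ← integral_const_mul]
  refine (norm_integral_le_integral_norm _).trans
    (integral_mono (integrable_mul_of_le_weight hu hf hC).norm ?_ fun x => ?_)
  · have := (integrable_weightedVolume_iff.1 hu).norm.const_mul C
    refine this.congr (ae_of_all _ fun x => ?_)
    simp [abs_of_pos (weight_pos x)]
  · simp only [norm_mul]
    calc ‖u x‖ * ‖f x‖ ≤ ‖u x‖ * (C * weight d ε x) := by
          gcongr
          exact hC x
      _ = _ := by ring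

lemma locallyIntegrable_of_weighted {u : Space d → ℝ}
    (hu : Integrable u (weightedVolume d ε)) : LocallyIntegrable u volume := by
  rw [locallyIntegrable_iff]
  intro K hK
  have hinv : ContinuousOn (fun x : Space d => (weight d ε x)⁻¹) K :=
    (continuous_weight.inv₀ fun x => (weight_pos x).ne').continuousOn
  have h := (integrable_weightedVolume_iff.1 hu).integrableOn (s := K)
  refine (h.mul_continuousOn hinv hK).congr (ae_of_all _ fun x => ?_)
  simp only
  field_simp [(weight_pos (ε := ε) x).ne']

lemma represents_of_forall {u : Space d → ℝ}
    (hu : Integrable u (weightedVolume d ε)) {ω : Tempered d}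
    (h : ∀ f : 𝓢(Space d, ℝ), ω f = ∫ x, u x * f x) :
    Represents ω u :=
  ⟨locallyIntegrable_of_weighted hu, fun f => ⟨integrable_mul_schwartz hu f, h f⟩⟩

/-- The tempered distribution given by a function in `L¹(g_ε dx)`. -/
def distributionOfL1 (u : Lp ℝ 1 (weightedVolume d ε)) : Tempered d :=
  StrongDual.toWeakDual <| SchwartzMap.mkCLMtoNormedSpace (σ := RingHom.id ℝ)
    (fun f : 𝓢(Space d, ℝ) => ∫ x, u x * f x)
    (fun f g => by
      have hu := L1.integrable_coeFn u
      rw [← integral_add (integrable_mul_schwartz hu f) (integrable_mul_schwartz hu g)]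
      simp [mul_add])
    (fun a f => by
      simp only [_root_.smul_apply, smul_eq_mul, RingHom.id_apply]
      rw [← integral_const_mul]
      congr 1
      funext x
      ring)
    (by
      have hu := L1.integrable_coeFn u
      obtain ⟨s, C, hC, h⟩ := exists_schwartz_le_weight d ε
      refine ⟨s, C * ∫ x, ‖u x‖ ∂(weightedVolume d ε), by positivity, fun f => ?_⟩
      refine (abs_integral_mul_le hu f.continuous.aestronglyMeasurable (h f)).trans_eq ?_
      ring)

lemma distributionOfL1_apply (u : Lp ℝ 1 (weightedVolume d ε)) (f : 𝓢(Space d, ℝ)) :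
    distributionOfL1 u f = ∫ x, u x * f x := rfl

lemma distributionOfL1_mem (u : Lp ℝ 1 (weightedVolume d ε)) :
    distributionOfL1 u ∈ weightedL1 d ε :=
  ⟨u, L1.integrable_coeFn u, represents_of_forall (L1.integrable_coeFn u) fun _ => rfl⟩

lemma continuous_distributionOfL1 :
    Continuous (distributionOfL1 : Lp ℝ 1 (weightedVolume d ε) → Tempered d) := by
  refine WeakDual.continuous_of_continuous_eval fun f => ?_
  obtain ⟨C, hC0, hC⟩ := exists_bound_weight f ε
  refine (LipschitzWith.of_dist_le_mul (K := ⟨C, hC0⟩) fun u v => ?_).continuous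
  have hu := L1.integrable_coeFn u
  have hv := L1.integrable_coeFn v
  rw [distributionOfL1_apply, distributionOfL1_apply, Real.dist_eq,
    ← integral_sub (integrable_mul_schwartz hu f) (integrable_mul_schwartz hv f), dist_eq_norm,
    L1.norm_eq_integral_norm]
  have h := abs_integral_mul_le (hu.sub hv) f.continuous.aestronglyMeasurable hC
  simp only [Pi.sub_apply, sub_mul] at h
  refine h.trans_eq ?_
  congr 1
  refine integral_congr_ae ?_
  filter_upwards [Lp.coeFn_sub u v] with x hx
  rw [hx, Pi.sub_apply]

/-- A random path that is almost surely the distribution of a measurable `L¹(g_ε dx)`-valued random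
variable has a law concentrated on `L¹(g_ε dx)`, in the sense of inner measure: the law on
`L¹(g_ε dx)` is tight, and the continuous image of a compact set in `𝓢'` is closed. -/
theorem iSup_map_distributionOfL1 {Ω : Type*} [MeasurableSpace Ω] {P : Measure Ω}
    [IsProbabilityMeasure P] {W : Ω → Lp ℝ 1 (weightedVolume d ε)}
    (hW : @AEMeasurable _ _ (borel _) _ W P) :
    ⨆ (B : Set (Tempered d)) (_ : MeasurableSet B ∧ B ⊆ weightedL1 d ε),
      P.map (fun ω => distributionOfL1 (W ω)) B = 1 := by
  borelize ↥(Lp ℝ 1 (weightedVolume d ε))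
  have hone : Fact ((1 : ℝ≥0∞) ≠ ∞) := ⟨ENNReal.one_ne_top⟩
  have hι := (continuous_distributionOfL1 (d := d) (ε := ε)).measurable
  have hmap : P.map (fun ω => distributionOfL1 (W ω)) = (P.map W).map distributionOfL1 :=
    (AEMeasurable.map_map_of_aemeasurable hι.aemeasurable hW).symm
  have hprob : IsProbabilityMeasure (P.map W) := Measure.isProbabilityMeasure_map hW
  have hprob' : IsProbabilityMeasure ((P.map W).map distributionOfL1) :=
    Measure.isProbabilityMeasure_map hι.aemeasurable
  rw [hmap]
  refine le_antisymm (iSup₂_le fun B _ => prob_le_one) (le_of_forall_lt fun q hq => ?_)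
  have hq' : q < (P.map W) Set.univ := by simpa using hq
  obtain ⟨K, -, hK, hqK⟩ := MeasurableSet.univ.exists_lt_isCompact_of_ne_top
    (measure_ne_top _ _) hq'
  have hKm : MeasurableSet (distributionOfL1 '' K) :=
    (hK.image continuous_distributionOfL1).isClosed.measurableSet
  refine lt_of_lt_of_le hqK (le_trans ?_ (le_iSup₂_of_le (distributionOfL1 '' K)
    ⟨hKm, ?_⟩ le_rfl))
  · rw [Measure.map_apply hι hKm]
    exact measure_mono (Set.subset_preimage_image _ _)
  · rintro _ ⟨u, -, rfl⟩
    exact distributionOfL1_mem u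

end Weight

/-! ### The field as a jointly measurable function -/

section Density

variable {d : ℕ} {ε : ℝ} {G : Space d → ℝ}

/-- The field smeared with the probe attached to the point `x`, as a function of the path and of
`x`. -/
def probeField (n : ℕ) (q : Tempered d × Space d) : ℝ :=
  q.1 ((probe d n).density ((probe d n).index q.2))

lemma measurable_probeField (n : ℕ) : Measurable (probeField (d := d) n) := by
  have h : Measurable fun q : Tempered d × Fin ((probe d n).last + 1) =>
      q.1 ((probe d n).density q.2) :=
    measurable_from_prod_countable_left fun i =>
      (WeakDual.eval_continuous ((probe d n).density i)).measurable
  exact h.comp (measurable_fst.prodMk ((probe d n).measurable_index.comp measurable_snd))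

lemma exists_bound_probeField (n : ℕ) (ω : Tempered d) : ∃ C, ∀ x, ‖probeField n (ω, x)‖ ≤ C :=
  ⟨∑ i, ‖ω ((probe d n).density i)‖, fun x =>
    Finset.single_le_sum (f := fun i => ‖ω ((probe d n).density i)‖) (fun _ _ => norm_nonneg _)
      (Finset.mem_univ ((probe d n).index x))⟩

lemma integrable_probeField (hε : 0 < ε) (n : ℕ) (ω : Tempered d) :
    Integrable (fun x => probeField n (ω, x)) (weightedVolume d ε) := by
  have := isFiniteMeasure_weightedVolume (d := d) hε
  obtain ⟨C, hC⟩ := exists_bound_probeField n ω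
  exact Integrable.of_bound
    ((measurable_probeField n).comp measurable_prodMk_left).aestronglyMeasurable C
    (ae_of_all _ hC)

lemma integral_comp_index {k : ℕ} {j : Space d → Fin k} (hj : Measurable j) {f : Space d → ℝ}
    (hf : Integrable f volume) (a : Fin k → ℝ) :
    ∫ x, f x * a (j x) = ∑ i, (∫ x in j ⁻¹' {i}, f x) * a i := by
  have hs : ∀ i, MeasurableSet (j ⁻¹' {i}) := fun i => hj (measurableSet_singleton i)
  have h : ∀ x, f x * a (j x) = ∑ i, (j ⁻¹' {i}).indicator f x * a i := by
    intro x
    rw [Finset.sum_eq_single (j x)]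
    · simp
    · intro i _ hi
      rw [Set.indicator_of_notMem, zero_mul]
      simpa using hi.symm
    · simp
  simp_rw [h]
  rw [integral_finsetSum _ fun i _ => (hf.indicator (hs i)).mul_const _]
  exact Finset.sum_congr rfl fun i _ => by rw [integral_mul_const, integral_indicator (hs i)]

/-- The test function obtained from `f` by smearing each point with its probe. -/
def probeSmear (n : ℕ) (f : 𝓢(Space d, ℝ)) : 𝓢(Space d, ℝ) :=
  ∑ i, (∫ x in (probe d n).index ⁻¹' {i}, f x) • (probe d n).density i

lemma eval_probeSmear (n : ℕ) (f : 𝓢(Space d, ℝ)) (ω : Tempered d) :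
    ω (probeSmear n f) = ∫ x, probeField n (ω, x) * f x := by
  have h := integral_comp_index (probe d n).measurable_index f.integrable
    (fun i => ω ((probe d n).density i))
  simp only [probeField, mul_comm _ (f _)]
  rw [h, probeSmear]
  simp [map_sum]

lemma transposeConv_probeSmear (hG : Integrable G volume) (n : ℕ) (f : 𝓢(Space d, ℝ))
    (y : Space d) : transposeConv G (probeSmear n f) y
      = ∫ x, f x * transposeConv G ((probe d n).density ((probe d n).index x)) y := by
  rw [integral_comp_index (probe d n).measurable_index f.integrable
    (fun i => transposeConv G ((probe d n).density i) y), probeSmear, transposeConv_sum _ hG]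

lemma measurable_transposeConv_probe (hGm : Measurable G) (n : ℕ) :
    Measurable fun q : Space d × Space d =>
      transposeConv G ((probe d n).density ((probe d n).index q.1)) q.2 := by
  have h : Measurable fun q : Fin ((probe d n).last + 1) × Space d =>
      transposeConv G ((probe d n).density q.1) q.2 :=
    measurable_from_prod_countable_right fun i =>
      measurable_transposeConv hGm ((probe d n).density i)
  exact h.comp (((probe d n).measurable_index.comp measurable_fst).prodMk measurable_snd)

/-- A bound for the `L¹`-distance between the smeared kernel and the point kernel that tends to zero
pointwise and is dominated by a constant. -/
lemma exists_kernel_error (hGm : Measurable G) (hG : Integrable G volume) :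
    ∃ θ : ℕ → Space d → ℝ≥0∞, (∀ n, Measurable (θ n)) ∧
      (∀ n x, ∫⁻ y, ‖transposeConv G ((probe d n).density ((probe d n).index x)) y
        - G (x - y)‖ₑ ≤ θ n x) ∧
      ∀ ν : Measure (Space d), IsFiniteMeasure ν →
        Tendsto (fun n => ∫⁻ x, θ n x ∂ν) atTop (𝓝 0) := by
  classical
  obtain ⟨η, hη, hηG⟩ := exists_translate_modulus hG
  set A : ℝ≥0∞ := 2 * ∫⁻ y, ‖G y‖ₑ with hA
  have hAtop : A ≠ ∞ := ENNReal.mul_ne_top (by simp) hG.2.ne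
  let θ : ℕ → Space d → ℝ≥0∞ := fun n x =>
    (Metric.closedBall (0 : Space d) n).piecewise (fun _ => min (η n) A) (fun _ => A) x
  have hθm : ∀ n, Measurable (θ n) := fun n =>
    Measurable.piecewise measurableSet_closedBall measurable_const measurable_const
  refine ⟨θ, hθm, fun n x => ?_, fun ν hν => ?_⟩
  · have h2 := lintegral_transposeConv_probe_sub_le_two_mul hGm (probe d n) x
    by_cases hx : x ∈ Metric.closedBall (0 : Space d) n
    · simp only [θ, Set.piecewise_eq_of_mem _ _ _ hx]
      exact le_min (lintegral_transposeConv_probe_sub_le hGm hG (hηG n) (probe d n)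
        (by simpa using hx)) h2
    · simpa only [θ, Set.piecewise_eq_of_notMem _ _ _ hx] using h2
  · have h0 : ∫⁻ _, (0 : ℝ≥0∞) ∂ν = 0 := lintegral_zero
    rw [← h0]
    refine tendsto_lintegral_of_dominated_convergence (fun _ => A) hθm
      (fun n => ae_of_all _ fun x => ?_) ?_ (ae_of_all _ fun x => ?_)
    · by_cases hx : x ∈ Metric.closedBall (0 : Space d) n
      · simp only [θ, Set.piecewise_eq_of_mem _ _ _ hx]
        exact min_le_right _ _
      · simp only [θ, Set.piecewise_eq_of_notMem _ _ _ hx]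
        exact le_rfl
    · simpa using ENNReal.mul_ne_top hAtop (measure_ne_top ν _)
    · refine tendsto_of_tendsto_of_tendsto_of_le_of_le' tendsto_const_nhds hη
        (Eventually.of_forall fun _ => zero_le) ?_
      obtain ⟨N, hN⟩ := exists_nat_ge ‖x‖
      filter_upwards [eventually_ge_atTop N] with n hn
      have hx : x ∈ Metric.closedBall (0 : Space d) n := by
        simpa using hN.trans (by exact_mod_cast hn)
      simp only [θ, Set.piecewise_eq_of_mem _ _ _ hx]
      exact min_le_left _ _

lemma lintegral_enorm_mul_le_of_le_weight (g : Space d → ℝ) {h : Space d → ℝ} {C : ℝ}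
    (hC0 : 0 ≤ C) (hC : ∀ x, |h x| ≤ C * weight d ε x) :
    ∫⁻ x, ‖g x * h x‖ₑ ≤ ENNReal.ofReal C * ∫⁻ x, ‖g x‖ₑ ∂(weightedVolume d ε) := by
  rw [lintegral_weightedVolume, ← lintegral_const_mul' _ _ ENNReal.ofReal_ne_top]
  refine lintegral_mono fun x => ?_
  rw [enorm_mul, ← mul_assoc, ← ENNReal.ofReal_mul hC0, mul_comm]
  gcongr
  rw [Real.enorm_eq_ofReal_abs]
  exact ENNReal.ofReal_le_ofReal (hC x)

variable {P : Measure (Tempered d)} {C : ℝ≥0∞}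

lemma lintegral_probeField_sub_le (hGm : Measurable G)
    (hP : ∀ f : 𝓢(Space d, ℝ), ∫⁻ ω, ‖ω f‖ₑ ∂P ≤ C * ∫⁻ x, ‖transposeConv G f x‖ₑ)
    (hG : Integrable G volume) {θ : ℕ → Space d → ℝ≥0∞}
    (hθ : ∀ n x, ∫⁻ y, ‖transposeConv G ((probe d n).density ((probe d n).index x)) y
        - G (x - y)‖ₑ ≤ θ n x) (n m : ℕ) (x : Space d) :
    ∫⁻ ω, ‖probeField n (ω, x) - probeField m (ω, x)‖ₑ ∂P ≤ C * (θ n x + θ m x) := by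
  set f := (probe d n).density ((probe d n).index x) with hf
  set g := (probe d m).density ((probe d m).index x) with hg
  have hfm := measurable_transposeConv hGm f
  have hgm := measurable_transposeConv hGm g
  calc ∫⁻ ω, ‖probeField n (ω, x) - probeField m (ω, x)‖ₑ ∂P = ∫⁻ ω, ‖ω (f - g)‖ₑ ∂P := by
        simp [probeField, hf, hg, map_sub]
    _ ≤ C * ∫⁻ y, ‖transposeConv G (f - g) y‖ₑ := hP _
    _ ≤ C * ∫⁻ y, (‖transposeConv G f y - G (x - y)‖ₑ + ‖transposeConv G g y - G (x - y)‖ₑ) := by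
        gcongr with y
        rw [transposeConv_sub hG]
        calc ‖transposeConv G f y - transposeConv G g y‖ₑ
            = ‖(transposeConv G f y - G (x - y)) - (transposeConv G g y - G (x - y))‖ₑ := by
              congr 1
              ring
          _ ≤ _ := enorm_sub_le
    _ ≤ _ := by
        rw [lintegral_add_left (by fun_prop)]
        gcongr
        · exact hθ n x
        · exact hθ m x

lemma tendsto_lintegral_probeSmear (hGm : Measurable G) (hG : Integrable G volume) (hC : C ≠ ∞)
    (hP : ∀ f : 𝓢(Space d, ℝ), ∫⁻ ω, ‖ω f‖ₑ ∂P ≤ C * ∫⁻ x, ‖transposeConv G f x‖ₑ)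
    (f : 𝓢(Space d, ℝ)) :
    Tendsto (fun n => ∫⁻ ω, ‖ω (probeSmear n f) - ω f‖ₑ ∂P) atTop (𝓝 0) := by
  obtain ⟨θ, hθm, hθ, hθlim⟩ := exists_kernel_error hGm hG
  have hfm := f.continuous.measurable
  let ν : Measure (Space d) := volume.withDensity fun x => ‖f x‖ₑ
  have hν : IsFiniteMeasure ν := isFiniteMeasure_withDensity f.integrable.2.ne
  have hlim0 : Tendsto (fun n => C * ∫⁻ x, θ n x ∂ν) atTop (𝓝 0) := by
    simpa using ENNReal.Tendsto.const_mul (hθlim ν hν) (Or.inr hC)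
  refine tendsto_of_tendsto_of_tendsto_of_le_of_le tendsto_const_nhds hlim0
    (fun _ => zero_le) fun n => ?_
  have hker := measurable_transposeConv_probe hGm n
  calc ∫⁻ ω, ‖ω (probeSmear n f) - ω f‖ₑ ∂P = ∫⁻ ω, ‖ω (probeSmear n f - f)‖ₑ ∂P := by
        simp [map_sub]
    _ ≤ C * ∫⁻ y, ‖transposeConv G (probeSmear n f - f) y‖ₑ := hP _
    _ ≤ C * ∫⁻ y, ∫⁻ x, ‖f x‖ₑ *
          ‖transposeConv G ((probe d n).density ((probe d n).index x)) y - G (x - y)‖ₑ := by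
        gcongr with y
        have hint : Integrable (fun x => f x *
            transposeConv G ((probe d n).density ((probe d n).index x)) y) volume := by
          refine f.integrable.mul_bdd (c := ∑ i, ‖transposeConv G ((probe d n).density i) y‖)
            (hker.comp measurable_prodMk_right).aestronglyMeasurable (ae_of_all _ fun x => ?_)
          exact Finset.single_le_sum (f := fun i => ‖transposeConv G ((probe d n).density i) y‖)
            (fun _ _ => norm_nonneg _) (Finset.mem_univ ((probe d n).index x))
        have hint' : Integrable (fun x => f x * G (x - y)) volume := by
          simpa only [mul_comm] using integrable_comp_sub_mul hG f y
        have heq : transposeConv G (probeSmear n f - f) y = ∫ x, f x *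
            (transposeConv G ((probe d n).density ((probe d n).index x)) y - G (x - y)) := by
          simp_rw [mul_sub]
          rw [transposeConv_sub hG, transposeConv_probeSmear hG, integral_sub hint hint']
          simp only [transposeConv, mul_comm (f _)]
        rw [heq]
        refine (enorm_integral_le_lintegral_enorm _).trans_eq ?_
        simp
    _ = C * ∫⁻ x, ∫⁻ y, ‖f x‖ₑ *
          ‖transposeConv G ((probe d n).density ((probe d n).index x)) y - G (x - y)‖ₑ := by
        congr 1
        refine lintegral_lintegral_swap (Measurable.aemeasurable ?_)
        have h1 : Measurable fun q : Space d × Space d =>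
          transposeConv G ((probe d n).density ((probe d n).index q.2)) q.1 :=
          hker.comp measurable_swap
        unfold Function.uncurry
        fun_prop
    _ ≤ C * ∫⁻ x, ‖f x‖ₑ * θ n x := by
        gcongr with x
        have h1 : Measurable fun y =>
          transposeConv G ((probe d n).density ((probe d n).index x)) y :=
          hker.comp measurable_prodMk_left
        rw [lintegral_const_mul _ (by fun_prop)]
        gcongr
        exact hθ n x
    _ = C * ∫⁻ x, θ n x ∂ν := by
        congr 1
        exact (lintegral_withDensity_eq_lintegral_mul _ hfm.enorm (hθm n)).symm

variable [IsProbabilityMeasure P]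

/-- The smeared fields converge in `L¹(P ⊗ g_ε dx)`. -/
theorem exists_limit_probeField (hε : 0 < ε) (hGm : Measurable G) (hG : Integrable G volume)
    (hC : C ≠ ∞)
    (hP : ∀ f : 𝓢(Space d, ℝ), ∫⁻ ω, ‖ω f‖ₑ ∂P ≤ C * ∫⁻ x, ‖transposeConv G f x‖ₑ) :
    ∃ U : Tempered d × Space d → ℝ, StronglyMeasurable U ∧
      Integrable U (P.prod (weightedVolume d ε)) ∧
      Tendsto (fun n => ∫⁻ ω, ∫⁻ x, ‖probeField n (ω, x) - U (ω, x)‖ₑ ∂(weightedVolume d ε) ∂P)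
        atTop (𝓝 0) := by
  have hμ := isFiniteMeasure_weightedVolume (d := d) hε
  set μ := weightedVolume d ε
  obtain ⟨θ, hθm, hθ, hθlim⟩ := exists_kernel_error hGm hG
  have hm := fun n => measurable_probeField (d := d) n
  have hmem : ∀ n, MemLp (probeField n) 1 (P.prod μ) := by
    intro n
    rw [memLp_one_iff_integrable]
    refine ⟨(hm n).aestronglyMeasurable, ?_⟩
    rw [hasFiniteIntegral_iff_enorm, lintegral_prod_symm _ (hm n).enorm.aemeasurable]
    calc ∫⁻ x, ∫⁻ ω, ‖probeField n (ω, x)‖ₑ ∂P ∂μ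
        ≤ ∫⁻ _, C * ((∫⁻ y, ‖G y‖ₑ) * 1) ∂μ := by
          refine lintegral_mono fun x =>
            (hP ((probe d n).density ((probe d n).index x))).trans ?_
          gcongr
          exact (lintegral_transposeConv_le hGm _).trans_eq
            (by rw [(probe d n).lintegral_density])
      _ < ∞ := by
          rw [lintegral_const, mul_one]
          exact ENNReal.mul_lt_top (ENNReal.mul_lt_top hC.lt_top hG.2) (measure_lt_top _ _)
  let F : ℕ → Lp ℝ 1 (P.prod μ) := fun n => (hmem n).toLp _
  have hlim0 : Tendsto (fun n => C * ∫⁻ x, θ n x ∂μ) atTop (𝓝 0) := by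
    simpa using ENNReal.Tendsto.const_mul (hθlim μ hμ) (Or.inr hC)
  have hedist : ∀ n m, edist (F n) (F m) ≤ (C * ∫⁻ x, θ n x ∂μ) + C * ∫⁻ x, θ m x ∂μ := by
    intro n m
    rw [Lp.edist_toLp_toLp, eLpNorm_one_eq_lintegral_enorm,
      lintegral_prod_symm _ ((hm n).sub (hm m)).enorm.aemeasurable]
    calc _ ≤ ∫⁻ x, C * (θ n x + θ m x) ∂μ :=
          lintegral_mono fun x => lintegral_probeField_sub_le hGm hP hG hθ n m x
      _ = _ := by
          have := hθm n
          have := hθm m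
          rw [lintegral_const_mul _ (by fun_prop), lintegral_add_left (hθm n), mul_add]
  have hcauchy : CauchySeq F := by
    rw [EMetric.cauchySeq_iff]
    intro δ hδ
    have hδ2 : 0 < δ / 2 := ENNReal.half_pos hδ.ne'
    obtain ⟨N, hN⟩ := eventually_atTop.1 (hlim0.eventually_lt_const hδ2)
    refine ⟨N, fun n hn m hm => (hedist n m).trans_lt ?_⟩
    calc _ < δ / 2 + δ / 2 := ENNReal.add_lt_add (hN n hn) (hN m hm)
      _ = δ := ENNReal.add_halves δ
  obtain ⟨L, hL⟩ := cauchySeq_tendsto_of_complete hcauchy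
  refine ⟨L, Lp.stronglyMeasurable L, L1.integrable_coeFn L, ?_⟩
  have h := (tendsto_iff_edist_tendsto_0.1 hL)
  refine h.congr fun n => ?_
  have hLm := (Lp.stronglyMeasurable L).measurable
  rw [Lp.edist_def, eLpNorm_one_eq_lintegral_enorm]
  have h2 : ∫⁻ q, ‖(⇑(F n) - ⇑L) q‖ₑ ∂(P.prod μ) = ∫⁻ q, ‖probeField n q - L q‖ₑ ∂(P.prod μ) := by
    refine lintegral_congr_ae ?_
    filter_upwards [(hmem n).coeFn_toLp] with q hq
    simp only [Pi.sub_apply, F, hq]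
  have h3 : Measurable fun q => probeField n q - L q := (hm n).sub hLm
  rw [h2, lintegral_prod _ h3.enorm.aemeasurable]

/-- The limit of the smeared fields represents the field against each fixed test function. -/
lemma ae_eval_eq_integral (hε : 0 < ε) (hGm : Measurable G) (hG : Integrable G volume)
    (hC : C ≠ ∞)
    (hP : ∀ f : 𝓢(Space d, ℝ), ∫⁻ ω, ‖ω f‖ₑ ∂P ≤ C * ∫⁻ x, ‖transposeConv G f x‖ₑ)
    {U : Tempered d × Space d → ℝ} (hU : StronglyMeasurable U)
    (hUint : Integrable U (P.prod (weightedVolume d ε)))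
    (hlim : Tendsto (fun n => ∫⁻ ω, ∫⁻ x, ‖probeField n (ω, x) - U (ω, x)‖ₑ
      ∂(weightedVolume d ε) ∂P) atTop (𝓝 0)) (f : 𝓢(Space d, ℝ)) :
    ∀ᵐ ω ∂P, ω f = ∫ x, U (ω, x) * f x := by
  have hμ := isFiniteMeasure_weightedVolume (d := d) hε
  obtain ⟨K, hK0, hK⟩ := exists_bound_weight f ε
  have hfm := f.continuous.measurable
  have hUf : Measurable fun ω => ∫ x, U (ω, x) * f x := by
    have : StronglyMeasurable (Function.uncurry fun (ω : Tempered d) x => U (ω, x) * f x) := by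
      have := hU.measurable
      refine Measurable.stronglyMeasurable ?_
      unfold Function.uncurry
      fun_prop
    exact this.integral_prod_right.measurable
  have hωf : ∀ g : 𝓢(Space d, ℝ), Measurable fun ω : Tempered d => ω g :=
    fun g => (WeakDual.eval_continuous g).measurable
  have hzero : ∫⁻ ω, ‖ω f - ∫ x, U (ω, x) * f x‖ₑ ∂P = 0 := by
    have hlim2 : Tendsto (fun n => (∫⁻ ω, ‖ω (probeSmear n f) - ω f‖ₑ ∂P) +
        ENNReal.ofReal K * ∫⁻ ω, ∫⁻ x, ‖probeField n (ω, x) - U (ω, x)‖ₑ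
          ∂(weightedVolume d ε) ∂P) atTop (𝓝 0) := by
      simpa using (tendsto_lintegral_probeSmear hGm hG hC hP f).add
        (ENNReal.Tendsto.const_mul hlim (Or.inr (ENNReal.ofReal_ne_top (r := K))))
    refine le_antisymm (ge_of_tendsto' hlim2 fun n => ?_) zero_le
    have h0 : Measurable fun ω : Tempered d => ω (probeSmear n f) - ω f := (hωf _).sub (hωf _)
    rw [← lintegral_const_mul' _ _ ENNReal.ofReal_ne_top, ← lintegral_add_left h0.enorm]
    refine lintegral_mono_ae ?_
    filter_upwards [hUint.prod_right_ae] with ω hω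
    have h1 : ω (probeSmear n f) - ∫ x, U (ω, x) * f x
        = ∫ x, (probeField n (ω, x) - U (ω, x)) * f x := by
      rw [eval_probeSmear]
      simp_rw [sub_mul]
      exact (integral_sub (integrable_mul_schwartz (integrable_probeField hε n ω) f)
        (integrable_mul_schwartz hω f)).symm
    calc ‖ω f - ∫ x, U (ω, x) * f x‖ₑ
        = ‖(ω (probeSmear n f) - ∫ x, U (ω, x) * f x) - (ω (probeSmear n f) - ω f)‖ₑ := by
          congr 1
          ring
      _ ≤ ‖ω (probeSmear n f) - ∫ x, U (ω, x) * f x‖ₑ + ‖ω (probeSmear n f) - ω f‖ₑ :=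
          enorm_sub_le
      _ ≤ _ := by
          rw [add_comm, h1]
          gcongr
          exact (enorm_integral_le_lintegral_enorm _).trans
            (lintegral_enorm_mul_le_of_le_weight _ hK0 hK)
  have hsub : Measurable fun ω : Tempered d => ω f - ∫ x, U (ω, x) * f x := (hωf f).sub hUf
  rw [lintegral_eq_zero_iff hsub.enorm] at hzero
  filter_upwards [hzero] with ω hω
  simpa [sub_eq_zero] using hω

/-- Almost every path is represented by the section of the limit of the smeared fields: the
identity for a fixed test function extends from a countable dense set by continuity. -/
theorem ae_represents (hε : 0 < ε) (hGm : Measurable G) (hG : Integrable G volume)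
    (hC : C ≠ ∞)
    (hP : ∀ f : 𝓢(Space d, ℝ), ∫⁻ ω, ‖ω f‖ₑ ∂P ≤ C * ∫⁻ x, ‖transposeConv G f x‖ₑ)
    {U : Tempered d × Space d → ℝ} (hU : StronglyMeasurable U)
    (hUint : Integrable U (P.prod (weightedVolume d ε)))
    (hlim : Tendsto (fun n => ∫⁻ ω, ∫⁻ x, ‖probeField n (ω, x) - U (ω, x)‖ₑ
      ∂(weightedVolume d ε) ∂P) atTop (𝓝 0)) :
    ∀ᵐ ω ∂P, Integrable (fun x => U (ω, x)) (weightedVolume d ε) ∧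
      Represents ω fun x => U (ω, x) := by
  have hμ := isFiniteMeasure_weightedVolume (d := d) hε
  obtain ⟨D, hDc, hD⟩ := exists_countable_dense_schwartz (E := Space d)
  have hall := (ae_ball_iff hDc).2 fun f _ =>
    ae_eval_eq_integral hε hGm hG hC hP hU hUint hlim f
  filter_upwards [hall, hUint.prod_right_ae] with ω hω hint
  refine ⟨hint, represents_of_forall hint fun f => ?_⟩
  have hT : ∀ f, distributionOfL1 (hint.toL1 _) f = ∫ x, U (ω, x) * f x := by
    intro f
    rw [distributionOfL1_apply]
    refine integral_congr_ae ?_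
    filter_upwards [absolutelyContinuous_weightedVolume.ae_le hint.coeFn_toL1] with x hx
    rw [hx]
  rw [← hT]
  have h1 : Continuous fun f : 𝓢(Space d, ℝ) => ω f := map_continuous ω
  have h2 : Continuous fun f : 𝓢(Space d, ℝ) => distributionOfL1 (hint.toL1 _) f :=
    map_continuous (distributionOfL1 (hint.toL1 _))
  exact congrFun (h1.ext_on hD h2 fun g hg => (hω g hg).trans (hT g).symm) f

end Density

/-! ### Exponential moments of local `L¹`-norms -/

section ExponentialMoment

variable {d : ℕ} {ε : ℝ} {G : Space d → ℝ}

lemma exists_bound_indicator {Λ : Set (Space d)} (hΛ : IsCompact Λ) (ε : ℝ) :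
    ∃ C, 0 ≤ C ∧ ∀ x, |Λ.indicator (fun _ => (1 : ℝ)) x| ≤ C * weight d ε x := by
  have hcont : ContinuousOn (fun x : Space d => (weight d ε x)⁻¹) Λ :=
    (continuous_weight.inv₀ fun x => (weight_pos x).ne').continuousOn
  obtain ⟨C, hC⟩ := hΛ.exists_bound_of_continuousOn hcont
  refine ⟨max C 0, le_max_right _ _, fun x => ?_⟩
  by_cases hx : x ∈ Λ
  · have h1 := hC x hx
    have hw := weight_pos (ε := ε) x
    rw [Real.norm_of_nonneg (by positivity), inv_le_iff_one_le_mul₀ hw] at h1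
    simp only [hx, Set.indicator_of_mem, abs_one]
    calc (1 : ℝ) ≤ C * weight d ε x := h1
      _ ≤ _ := by
        gcongr
        exact le_max_left _ _
  · have hw := weight_pos (ε := ε) x
    simp only [hx, not_false_eq_true, Set.indicator_of_notMem, abs_zero]
    positivity

lemma integrableOn_of_weighted {Λ : Set (Space d)} (hΛ : IsCompact Λ) {u : Space d → ℝ}
    (hu : Integrable u (weightedVolume d ε)) : IntegrableOn u Λ volume :=
  (locallyIntegrable_of_weighted hu).integrableOn_isCompact hΛ

lemma setLIntegral_enorm_le_of_weighted {Λ : Set (Space d)} (hΛ : MeasurableSet Λ) {C : ℝ}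
    (hC0 : 0 ≤ C) (hC : ∀ x, |Λ.indicator (fun _ => (1 : ℝ)) x| ≤ C * weight d ε x)
    (g : Space d → ℝ) :
    ∫⁻ x in Λ, ‖g x‖ₑ ≤ ENNReal.ofReal C * ∫⁻ x, ‖g x‖ₑ ∂(weightedVolume d ε) := by
  refine le_trans (le_of_eq ?_) (lintegral_enorm_mul_le_of_le_weight g hC0 hC)
  rw [← lintegral_indicator hΛ]
  refine lintegral_congr fun x => ?_
  by_cases hx : x ∈ Λ <;> simp [hx]

/-- An integral over the index of the probe is a finite sum over the probes. -/
lemma sum_index_eq_setIntegral {k : ℕ} {j : Space d → Fin k} (hj : Measurable j)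
    {Λ : Set (Space d)} (hΛ : IsCompact Λ) (a : Fin k → ℝ) :
    ∑ i, ((volume.restrict Λ).map j).real {i} * |a i| = ∫ x in Λ, |a (j x)| := by
  have hfin : IsFiniteMeasure (volume.restrict Λ) := ⟨by simpa using hΛ.measure_lt_top⟩
  rw [← integral_map (φ := j) (f := fun i => |a i|) hj.aemeasurable
    (measurable_of_finite _).aestronglyMeasurable, integral_fintype Integrable.of_finite]
  simp

lemma lintegral_probe_kernel_le (hGm : Measurable G) {Λ : Set (Space d)} (n : ℕ)
    (hn : Λ ⊆ Metric.closedBall 0 n) (y : Space d) :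
    ∫⁻ x in Λ, ‖transposeConv G ((probe d n).density ((probe d n).index x)) y‖ₑ
      ≤ 3 ^ d * ∫⁻ w, ‖G w‖ₑ := by
  have hprobe : Measurable fun q : Space d × Space d =>
      (probe d n).density ((probe d n).index q.1) q.2 := by
    have h : Measurable fun q : Fin ((probe d n).last + 1) × Space d =>
        (probe d n).density q.1 q.2 :=
      measurable_from_prod_countable_right fun i => ((probe d n).density i).continuous.measurable
    exact h.comp (((probe d n).measurable_index.comp measurable_fst).prodMk measurable_snd)
  calc ∫⁻ x in Λ, ‖transposeConv G ((probe d n).density ((probe d n).index x)) y‖ₑ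
      ≤ ∫⁻ x in Λ, ∫⁻ w, ‖G (w - y)‖ₑ * ‖(probe d n).density ((probe d n).index x) w‖ₑ := by
        refine lintegral_mono fun x => (enorm_integral_le_lintegral_enorm _).trans_eq ?_
        simp
    _ = ∫⁻ w, ∫⁻ x in Λ, ‖G (w - y)‖ₑ * ‖(probe d n).density ((probe d n).index x) w‖ₑ := by
        refine lintegral_lintegral_swap (Measurable.aemeasurable ?_)
        unfold Function.uncurry
        fun_prop
    _ ≤ ∫⁻ w, ‖G (w - y)‖ₑ * 3 ^ d := by
        refine lintegral_mono fun w => ?_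
        simp only
        have h1 : Measurable fun x => (probe d n).density ((probe d n).index x) w :=
          hprobe.comp measurable_prodMk_right
        rw [lintegral_const_mul _ h1.enorm]
        gcongr
        exact (lintegral_mono_set hn).trans ((probe d n).average_le w)
    _ = _ := by
        rw [lintegral_mul_const _ (by fun_prop), mul_comm]
        congr 1
        exact lintegral_sub_right_eq_self (fun w => ‖G w‖ₑ) y

lemma lintegral_lintegral_probe_kernel_le (hGm : Measurable G) (Λ : Set (Space d)) (n : ℕ) :
    ∫⁻ y, ∫⁻ x in Λ, ‖transposeConv G ((probe d n).density ((probe d n).index x)) y‖ₑ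
      ≤ volume Λ * ∫⁻ w, ‖G w‖ₑ := by
  have hker := measurable_transposeConv_probe hGm n
  calc _ = ∫⁻ x in Λ, ∫⁻ y,
        ‖transposeConv G ((probe d n).density ((probe d n).index x)) y‖ₑ := by
        refine lintegral_lintegral_swap (Measurable.aemeasurable ?_)
        exact (hker.comp measurable_swap).enorm
    _ ≤ ∫⁻ _ in Λ, ∫⁻ w, ‖G w‖ₑ := by
        refine lintegral_mono fun x => (lintegral_transposeConv_le hGm _).trans_eq ?_
        rw [(probe d n).lintegral_density, mul_one]
    _ = _ := by rw [setLIntegral_const, mul_comm]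

variable {z c : ℝ} {r : Measure ℝ} [IsProbabilityMeasure r] {PX : Measure (Tempered d)}
  [IsProbabilityMeasure PX]

/-- Exponential moments of the local `L¹`-norm of the smeared fields, uniformly in the smearing. The
local `L¹`-norm is a finite-dimensional seminorm of values of the field, and the same seminorm of
the kernels is bounded by `3 ^ d * ‖G‖₁` and has integral at most `|Λ| ‖G‖₁`. -/
theorem lintegral_exp_probeField_le (hGm : Measurable G) (hG : Integrable G volume) (hz : 0 ≤ z)
    (hc : 0 ≤ c) (hr : ∀ᵐ s ∂r, |s| ≤ c)
    (hX : ∀ f : 𝓢(Space d, ℝ), ∫ ω, Complex.exp (Complex.I * (ω f : ℂ)) ∂PX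
      = Complex.exp (∫ x, poissonCharacteristic z r (transposeConv G f x)))
    {Λ : Set (Space d)} (hΛ : IsCompact Λ) {α : ℝ} (hα : 0 ≤ α) {n : ℕ}
    (hn : Λ ⊆ Metric.closedBall 0 n) :
    ∫⁻ ω, ENNReal.ofReal (Real.exp (α * ∫ x in Λ, |probeField n (ω, x)|)) ∂PX
      ≤ ENNReal.ofReal (Real.exp (z * c * (α * (volume.real Λ * ∫ w, ‖G w‖)) *
          Real.exp (c * (α * (3 ^ d * ∫ w, ‖G w‖))))) := by
  set Q := probe d n with hQ
  set κ : Fin (Q.last + 1) → ℝ := fun i => ((volume.restrict Λ).map Q.index).real {i} with hκ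
  have hκ0 : ∀ i, 0 ≤ κ i := fun i => measureReal_nonneg
  have hsum : ∀ a : Fin (Q.last + 1) → ℝ, ∑ i, κ i * |a i| = ∫ x in Λ, |a (Q.index x)| :=
    sum_index_eq_setIntegral Q.measurable_index hΛ
  have hfin : IsFiniteMeasure (volume.restrict Λ) := ⟨by simpa using hΛ.measure_lt_top⟩
  have hker := measurable_transposeConv_probe hGm n
  rw [← hQ] at hker
  have hsumE : ∀ y, ENNReal.ofReal (∫ x in Λ, |transposeConv G (Q.density (Q.index x)) y|)
      = ∫⁻ x in Λ, ‖transposeConv G (Q.density (Q.index x)) y‖ₑ := by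
    intro y
    have hint : Integrable (fun x => transposeConv G (Q.density (Q.index x)) y)
        (volume.restrict Λ) := by
      refine Integrable.of_bound (C := ∑ i, ‖transposeConv G (Q.density i) y‖)
        (hker.comp measurable_prodMk_right).aestronglyMeasurable (ae_of_all _ fun x => ?_)
      exact Finset.single_le_sum (f := fun i => ‖transposeConv G (Q.density i) y‖)
        (fun _ _ => norm_nonneg _) (Finset.mem_univ (Q.index x))
    rw [← ofReal_integral_norm_eq_lintegral_enorm hint]
    rfl
  have hGe : ∫⁻ w, ‖G w‖ₑ = ENNReal.ofReal (∫ w, ‖G w‖) :=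
    (ofReal_integral_norm_eq_lintegral_enorm hG).symm
  have hG0 : 0 ≤ ∫ w, ‖G w‖ := by positivity
  have hkernel : ∀ y, ∑ i, κ i * |kernelVec G Q.density y i|
      = ∫ x in Λ, |transposeConv G (Q.density (Q.index x)) y| := fun y =>
    hsum fun i => transposeConv G (Q.density i) y
  have key := lintegral_exp_evalVec_le hGm hG hz hc hr hX Q.density
    (p := fun y => α * ∑ i, κ i * |y i|) (by fun_prop)
    (fun x y => by
      rw [← mul_add, ← Finset.sum_add_distrib]
      refine mul_le_mul_of_nonneg_left (Finset.sum_le_sum fun i _ => ?_) hα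
      rw [← mul_add]
      exact mul_le_mul_of_nonneg_left (abs_add_le _ _) (hκ0 i))
    (fun y => mul_nonneg hα (Finset.sum_nonneg fun i _ => mul_nonneg (hκ0 i) (abs_nonneg _)))
    (fun s y => by
      simp only [PiLp.smul_apply, smul_eq_mul, abs_mul, Finset.mul_sum]
      exact Finset.sum_congr rfl fun i _ => by ring)
    (M := α * (3 ^ d * ∫ w, ‖G w‖)) (K := α * (volume.real Λ * ∫ w, ‖G w‖)) (by positivity)
    (fun y => by
      refine mul_le_mul_of_nonneg_left ?_ hα
      rw [hkernel, ← ENNReal.ofReal_le_ofReal_iff (by positivity), hsumE,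
        ENNReal.ofReal_mul (by positivity), ← hGe, ENNReal.ofReal_pow (by norm_num)]
      simpa using lintegral_probe_kernel_le hGm n hn y)
    (by
      simp_rw [ENNReal.ofReal_mul hα, hkernel, hsumE]
      rw [lintegral_const_mul' _ _ ENNReal.ofReal_ne_top, ENNReal.ofReal_mul measureReal_nonneg,
        ← hGe, ofReal_measureReal hΛ.measure_lt_top.ne]
      gcongr
      exact lintegral_lintegral_probe_kernel_le hGm Λ n)
  refine le_trans (le_of_eq (lintegral_congr fun ω => ?_)) key
  have h := hsum fun i => ω (Q.density i)
  simp only [evalVec]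
  rw [h]
  rfl

/-- Local `L¹`-norms of the field have exponential moments of all orders. -/
theorem lintegral_exp_setIntegral_lt_top (hε : 0 < ε) (hGm : Measurable G)
    (hG : Integrable G volume) (hz : 0 ≤ z) (hc : 0 ≤ c) (hr : ∀ᵐ s ∂r, |s| ≤ c)
    (hX : ∀ f : 𝓢(Space d, ℝ), ∫ ω, Complex.exp (Complex.I * (ω f : ℂ)) ∂PX
      = Complex.exp (∫ x, poissonCharacteristic z r (transposeConv G f x)))
    {U : Tempered d × Space d → ℝ} (hU : StronglyMeasurable U)
    (hUint : Integrable U (PX.prod (weightedVolume d ε)))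
    (hlim : Tendsto (fun n => ∫⁻ ω, ∫⁻ x, ‖probeField n (ω, x) - U (ω, x)‖ₑ
      ∂(weightedVolume d ε) ∂PX) atTop (𝓝 0))
    {Λ : Set (Space d)} (hΛ : IsCompact Λ) {α : ℝ} (hα : 0 ≤ α) :
    ∫⁻ ω, ENNReal.ofReal (Real.exp (α * ∫ x in Λ, |U (ω, x)|)) ∂PX < ∞ := by
  have hμ := isFiniteMeasure_weightedVolume (d := d) hε
  obtain ⟨K, hK0, hK⟩ := exists_bound_indicator hΛ ε
  let W : ℕ → Tempered d → ℝ := fun n ω => ∫ x in Λ, |probeField n (ω, x)|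
  let V : Tempered d → ℝ := fun ω => ∫ x in Λ, |U (ω, x)|
  have hWm : ∀ n, StronglyMeasurable (W n) := fun n =>
    StronglyMeasurable.integral_prod_right (f := fun ω x => |probeField n (ω, x)|)
      (measurable_probeField n).abs.stronglyMeasurable
  have hVm : StronglyMeasurable V :=
    StronglyMeasurable.integral_prod_right (f := fun ω x => |U (ω, x)|)
      hU.measurable.abs.stronglyMeasurable
  have hdiff : Tendsto (fun n => eLpNorm (W n - V) 1 PX) atTop (𝓝 0) := by
    have h0 : Tendsto (fun n => ENNReal.ofReal K * ∫⁻ ω, ∫⁻ x, ‖probeField n (ω, x) - U (ω, x)‖ₑ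
        ∂(weightedVolume d ε) ∂PX) atTop (𝓝 0) := by
      simpa using ENNReal.Tendsto.const_mul hlim (Or.inr (ENNReal.ofReal_ne_top (r := K)))
    refine tendsto_of_tendsto_of_tendsto_of_le_of_le tendsto_const_nhds h0
      (fun _ => zero_le) fun n => ?_
    simp only
    rw [eLpNorm_one_eq_lintegral_enorm, ← lintegral_const_mul' _ _ ENNReal.ofReal_ne_top]
    refine lintegral_mono_ae ?_
    filter_upwards [hUint.prod_right_ae] with ω hω
    have h1 := integrableOn_of_weighted hΛ hω
    have h2 := integrableOn_of_weighted hΛ (integrable_probeField hε n ω)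
    have h3 : (W n - V) ω = ∫ x in Λ, (|probeField n (ω, x)| - |U (ω, x)|) :=
      (integral_sub h2.abs h1.abs).symm
    rw [h3]
    refine (enorm_integral_le_lintegral_enorm _).trans ((lintegral_mono fun x => ?_).trans
      (setLIntegral_enorm_le_of_weighted hΛ.measurableSet hK0 hK _))
    simp only [Real.enorm_eq_ofReal_abs]
    exact ENNReal.ofReal_le_ofReal (abs_abs_sub_abs_le _ _)
  obtain ⟨ns, hns, hae⟩ := (tendstoInMeasure_of_tendsto_eLpNorm one_ne_zero
    (fun n => (hWm n).aestronglyMeasurable) hVm.aestronglyMeasurable hdiff).exists_seq_tendsto_ae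
  obtain ⟨N, hN⟩ : ∃ N : ℕ, Λ ⊆ Metric.closedBall 0 (N : ℝ) := by
    obtain ⟨R, hR⟩ := hΛ.isBounded.subset_closedBall (0 : Space d)
    obtain ⟨N, hN⟩ := exists_nat_ge R
    exact ⟨N, hR.trans (Metric.closedBall_subset_closedBall hN)⟩
  refine lt_of_le_of_lt ?_ (ENNReal.ofReal_lt_top (r :=
    Real.exp (z * c * (α * (volume.real Λ * ∫ w, ‖G w‖)) *
      Real.exp (c * (α * (3 ^ d * ∫ w, ‖G w‖))))))
  calc ∫⁻ ω, ENNReal.ofReal (Real.exp (α * V ω)) ∂PX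
      = ∫⁻ ω, liminf (fun k => ENNReal.ofReal (Real.exp (α * W (ns k) ω))) atTop ∂PX := by
        refine lintegral_congr_ae ?_
        filter_upwards [hae] with ω hω
        have hcont : Continuous fun t : ℝ => ENNReal.ofReal (Real.exp (α * t)) :=
          ENNReal.continuous_ofReal.comp (by fun_prop)
        exact ((hcont.tendsto _).comp hω).liminf_eq.symm
    _ ≤ liminf (fun k => ∫⁻ ω, ENNReal.ofReal (Real.exp (α * W (ns k) ω)) ∂PX) atTop :=
        lintegral_liminf_le fun k => by
          have := (hWm (ns k)).measurable
          fun_prop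
    _ ≤ liminf (fun _ : ℕ => ENNReal.ofReal (Real.exp (z * c * (α * (volume.real Λ * ∫ w, ‖G w‖)) *
          Real.exp (c * (α * (3 ^ d * ∫ w, ‖G w‖)))))) atTop := by
        refine liminf_le_liminf ?_
        filter_upwards [eventually_ge_atTop N] with k hk
        refine lintegral_exp_probeField_le hGm hG hz hc hr hX hΛ hα (hN.trans ?_)
        exact Metric.closedBall_subset_closedBall (by exact_mod_cast hk.trans (hns.id_le k))
    _ = _ := by simp

end ExponentialMoment

/-! ### Laws of fields with integrable paths -/

section PathLaw

variable {d : ℕ} {ε : ℝ}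

/-- A map into a separable metric space is measurable if its distance to each point is. -/
lemma measurable_of_measurable_dist {Ω E : Type*} [MeasurableSpace Ω] [PseudoMetricSpace E]
    [TopologicalSpace.SeparableSpace E] [MeasurableSpace E] [BorelSpace E] {f : Ω → E}
    (hf : ∀ w, Measurable fun ω => dist (f ω) w) : Measurable f := by
  refine measurable_of_isOpen fun O hO => ?_
  rcases isEmpty_or_nonempty E with hE | hE
  · convert MeasurableSet.empty
    ext ω
    exact (hE.false (f ω)).elim
  let D : ℕ → E := TopologicalSpace.denseSeq E
  have h : f ⁻¹' O = ⋃ (k : ℕ) (m : ℕ) (_ : Metric.ball (D k) (1 / ((m : ℝ) + 1)) ⊆ O),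
      {ω | dist (f ω) (D k) < 1 / ((m : ℝ) + 1)} := by
    ext ω
    simp only [Set.mem_preimage, Set.mem_iUnion, Set.mem_ofPred_eq, exists_prop]
    refine ⟨fun hω => ?_, fun ⟨k, m, hsub, hk⟩ => hsub hk⟩
    obtain ⟨δ, hδ, hball⟩ := Metric.isOpen_iff.1 hO _ hω
    obtain ⟨m, hm⟩ := exists_nat_one_div_lt (half_pos hδ)
    obtain ⟨k, hk⟩ := (TopologicalSpace.denseRange_denseSeq E).exists_dist_lt (f ω)
      (by positivity : (0 : ℝ) < 1 / ((m : ℝ) + 1))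
    refine ⟨k, m, fun y hy => hball ?_, hk⟩
    rw [Metric.mem_ball] at hy ⊢
    have := dist_triangle y (D k) (f ω)
    rw [dist_comm (D k)] at this
    linarith
  rw [h]
  exact MeasurableSet.iUnion fun k => MeasurableSet.iUnion fun m => MeasurableSet.iUnion fun _ =>
    measurableSet_lt (hf _) measurable_const

open Classical in
/-- The section `F (ω, ·)` as an element of `L¹(μ)`, zero if it is not integrable. -/
def sectionL1 {Ω X : Type*} [MeasurableSpace X] (μ : Measure X) (F : Ω × X → ℝ) (ω : Ω) :
    Lp ℝ 1 μ :=
  if h : Integrable (fun x => F (ω, x)) μ then h.toL1 _ else 0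

lemma coeFn_sectionL1 {Ω X : Type*} [MeasurableSpace X] {μ : Measure X} {F : Ω × X → ℝ} {ω : Ω}
    (h : Integrable (fun x => F (ω, x)) μ) : sectionL1 μ F ω =ᵐ[μ] fun x => F (ω, x) := by
  rw [sectionL1, dif_pos h]
  exact h.coeFn_toL1

lemma measurable_sectionL1 {Ω X : Type*} [MeasurableSpace Ω] [MeasurableSpace X]
    [MeasurableSpace.CountablyGenerated X] {μ : Measure X} [SFinite μ] {F : Ω × X → ℝ}
    (hF : StronglyMeasurable F) : @Measurable _ _ _ (borel _) (sectionL1 μ F) := by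
  borelize ↥(Lp ℝ 1 μ)
  have hone : Fact ((1 : ℝ≥0∞) ≠ ∞) := ⟨ENNReal.one_ne_top⟩
  have hset : MeasurableSet {ω | Integrable (fun x => F (ω, x)) μ} :=
    measurableSet_integrable (f := fun ω x => F (ω, x)) hF
  refine measurable_of_measurable_dist fun w => ?_
  classical
  have hw := (Lp.stronglyMeasurable w).measurable
  have h1 : Measurable fun ω => ∫ x, ‖F (ω, x) - w x‖ ∂μ := by
    refine (StronglyMeasurable.integral_prod_right (f := fun ω x => ‖F (ω, x) - w x‖) ?_).measurable
    have := hF.measurable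
    refine Measurable.stronglyMeasurable ?_
    unfold Function.uncurry
    fun_prop
  have h2 : (fun ω => dist (sectionL1 μ F ω) w) =
      {ω | Integrable (fun x => F (ω, x)) μ}.piecewise (fun ω => ∫ x, ‖F (ω, x) - w x‖ ∂μ)
        (fun _ => dist 0 w) := by
    funext ω
    by_cases h : Integrable (fun x => F (ω, x)) μ
    · rw [Set.piecewise_eq_of_mem _ _ _ (show ω ∈ {ω | Integrable (fun x => F (ω, x)) μ} from h),
        dist_eq_norm, L1.norm_eq_integral_norm]
      refine integral_congr_ae ?_
      filter_upwards [Lp.coeFn_sub (sectionL1 μ F ω) w, coeFn_sectionL1 h] with x hx1 hx2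
      rw [hx1, Pi.sub_apply, hx2]
    · rw [Set.piecewise_eq_of_notMem _ _ _
        (show ω ∉ {ω | Integrable (fun x => F (ω, x)) μ} from h), sectionL1, dif_neg h]
  rw [h2]
  exact Measurable.piecewise hset h1 measurable_const

lemma distributionOfL1_sectionL1 {Ω : Type*} {F : Ω × Space d → ℝ} {ω : Ω}
    (h : Integrable (fun x => F (ω, x)) (weightedVolume d ε)) (f : 𝓢(Space d, ℝ)) :
    distributionOfL1 (sectionL1 (weightedVolume d ε) F ω) f = ∫ x, F (ω, x) * f x := by
  rw [distributionOfL1_apply]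
  refine integral_congr_ae ?_
  filter_upwards [absolutelyContinuous_weightedVolume.ae_le (coeFn_sectionL1 h)] with x hx
  rw [hx]

variable {Ω : Type*} [MeasurableSpace Ω] {P : Measure Ω} [IsProbabilityMeasure P]

/-- A family of random variables that almost surely is the pairing with the sections of a jointly
measurable function in `L¹(g_ε dx)` is a random field with paths in `L¹(g_ε dx)`. -/
theorem isRandomField_and_hasPathsIn {Y : 𝓢(Space d, ℝ) → Ω → ℝ} {F : Ω × Space d → ℝ}
    (hF : StronglyMeasurable F)
    (hFint : ∀ᵐ ω ∂P, Integrable (fun x => F (ω, x)) (weightedVolume d ε))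
    (hY : ∀ᵐ ω ∂P, ∀ f, Y f ω = ∫ x, F (ω, x) * f x) :
    IsRandomField P Y ∧ HasPathsIn P Y (weightedL1 d ε) := by
  let W : Ω → Lp ℝ 1 (weightedVolume d ε) := sectionL1 (weightedVolume d ε) F
  have hW : @Measurable _ _ _ (borel _) W := measurable_sectionL1 hF
  have hT : Measurable fun ω => distributionOfL1 (W ω) := by
    borelize ↥(Lp ℝ 1 (weightedVolume d ε))
    exact continuous_distributionOfL1.measurable.comp hW
  have hYT : ∀ᵐ ω ∂P, ∀ f, distributionOfL1 (W ω) f = Y f ω := by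
    filter_upwards [hFint, hY] with ω hω1 hω2 f
    rw [hω2, ← distributionOfL1_sectionL1 hω1]
  have hYm : ∀ f, AEMeasurable (Y f) P := fun f =>
    ⟨fun ω => distributionOfL1 (W ω) f, (WeakDual.eval_continuous f).measurable.comp hT, by
      filter_upwards [hYT] with ω hω using (hω f).symm⟩
  refine ⟨⟨hYm, ?_, fun u f hu => ?_⟩, P.map fun ω => distributionOfL1 (W ω), ⟨?_, fun f => ?_⟩,
    iSup_map_distributionOfL1 (W := W) (@Measurable.aemeasurable _ _ _ (borel _) _ _ hW)⟩
  · filter_upwards [hYT] with ω hω s t f g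
    rw [← hω, ← hω, ← hω]
    simp
  · refine tendstoInDistribution_of_ae_tendsto (fun n => hYm (u n)) (hYm f) ?_
    filter_upwards [hYT] with ω hω
    simp_rw [← hω]
    exact ((map_continuous (distributionOfL1 (W ω))).tendsto f).comp hu
  · exact Measure.isProbabilityMeasure_map hT.aemeasurable
  · have hm : Measurable fun ω : Tempered d => coord f ω := (WeakDual.eval_continuous f).measurable
    rw [integral_map hT.aemeasurable (by fun_prop)]
    refine integral_congr_ae ?_
    filter_upwards [hYT] with ω hω
    simp only [coord]
    rw [hω]

end PathLaw

/-! ### Local functions of the field -/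

section Nonlinear

variable {d : ℕ} {ε : ℝ}

lemma Represents.ae_eq {ω : Tempered d} {u u' : Space d → ℝ} (h : Represents ω u)
    (h' : Represents ω u') : u =ᵐ[volume] u' := by
  refine ae_eq_of_integral_contDiff_smul_eq h.1 h'.1 fun g hg hgc => ?_
  have h1 := ((h.2 (hgc.toSchwartzMap hg)).2).symm.trans (h'.2 (hgc.toSchwartzMap hg)).2
  simpa [mul_comm] using h1

lemma nonlinear_ae_eq {v : ℝ → ℝ} {ω : Tempered d} {u : Space d → ℝ} (h : Represents ω u) :
    nonlinear v ω =ᵐ[volume] fun x => v (u x) := by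
  have hex : ∃ u, Represents ω u := ⟨u, h⟩
  rw [nonlinear, dif_pos hex]
  filter_upwards [hex.choose_spec.ae_eq h] with x hx
  rw [hx]

lemma nonlinearPairing_eq {v : ℝ → ℝ} {ω : Tempered d} {u : Space d → ℝ} (h : Represents ω u)
    (φ : Space d → ℝ) : nonlinearPairing v φ ω = ∫ x, v (u x) * φ x := by
  refine integral_congr_ae ?_
  filter_upwards [nonlinear_ae_eq (v := v) h] with x hx
  rw [hx]

lemma integrable_comp_of_linear_growth {μ : Measure (Space d)} [IsFiniteMeasure μ] {v : ℝ → ℝ}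
    (hv : Measurable v) {a b : ℝ} (hvab : ∀ t, |v t| ≤ a + b * |t|) {u : Space d → ℝ}
    (hu : Integrable u μ) : Integrable (fun x => v (u x)) μ :=
  ((integrable_const a).add (hu.abs.const_mul b)).mono'
    (hv.comp_aemeasurable hu.1.aemeasurable).aestronglyMeasurable
    (ae_of_all _ fun x => hvab (u x))

variable {P : Measure (Tempered d)}

/-- If almost every path is represented by the section of a jointly measurable function whose local
`L¹`-norm has all exponential moments, then the interaction has all exponential moments. -/
theorem integrable_exp_interaction (hε : 0 < ε) {U : Tempered d × Space d → ℝ}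
    (hU : StronglyMeasurable U)
    (hrep : ∀ᵐ ω ∂P, Integrable (fun x => U (ω, x)) (weightedVolume d ε) ∧
      Represents ω fun x => U (ω, x))
    {Λ : Set (Space d)} (hΛ : IsCompact Λ)
    (hexp : ∀ α : ℝ, 0 ≤ α →
      ∫⁻ ω, ENNReal.ofReal (Real.exp (α * ∫ x in Λ, |U (ω, x)|)) ∂P < ∞)
    {v : ℝ → ℝ} (hv : Measurable v) {a b : ℝ} (hb : 0 ≤ b)
    (hvab : ∀ t, |v t| ≤ a + b * |t|) (t : ℝ) :
    Integrable (fun ω => Real.exp (t * interaction v Λ ω)) P := by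
  have hμ := isFiniteMeasure_weightedVolume (d := d) hε
  have hfin : IsFiniteMeasure (volume.restrict Λ) := ⟨by simpa using hΛ.measure_lt_top⟩
  have hint : ∀ᵐ ω ∂P, interaction v Λ ω = ∫ x in Λ, v (U (ω, x)) := by
    filter_upwards [hrep] with ω hω
    rw [interaction, nonlinearPairing_eq hω.2, ← integral_indicator hΛ.measurableSet]
    congr 1
    funext x
    by_cases hx : x ∈ Λ <;> simp [hx]
  have hm : StronglyMeasurable fun ω => ∫ x in Λ, v (U (ω, x)) :=
    StronglyMeasurable.integral_prod_right (f := fun ω x => v (U (ω, x)))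
      (hv.comp hU.measurable).stronglyMeasurable
  have hWm : StronglyMeasurable fun ω => ∫ x in Λ, |U (ω, x)| :=
    StronglyMeasurable.integral_prod_right (f := fun ω x => |U (ω, x)|)
      hU.measurable.abs.stronglyMeasurable
  have hdom : Integrable (fun ω => Real.exp (|t| * (volume.real Λ * a)) *
      Real.exp (|t| * b * ∫ x in Λ, |U (ω, x)|)) P := by
    refine Integrable.const_mul ⟨?_, ?_⟩ _
    · have := hWm.measurable
      exact (by fun_prop : Measurable fun ω =>
        Real.exp (|t| * b * ∫ x in Λ, |U (ω, x)|)).aestronglyMeasurable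
    · rw [hasFiniteIntegral_iff_ofReal (ae_of_all _ fun ω => (Real.exp_pos _).le)]
      exact hexp _ (by positivity)
  refine hdom.mono' ?_ ?_
  · refine AEStronglyMeasurable.congr (f := fun ω => Real.exp (t * ∫ x in Λ, v (U (ω, x)))) ?_ ?_
    · have := hm.measurable
      exact (by fun_prop : Measurable fun ω =>
        Real.exp (t * ∫ x in Λ, v (U (ω, x)))).aestronglyMeasurable
    · filter_upwards [hint] with ω hω
      rw [hω]
  · filter_upwards [hint, hrep] with ω hω hr
    rw [hω, Real.norm_of_nonneg (Real.exp_pos _).le, ← Real.exp_add, Real.exp_le_exp]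
    have hUΛ : Integrable (fun x => U (ω, x)) (volume.restrict Λ) :=
      integrableOn_of_weighted hΛ hr.1
    have h1 : |∫ x in Λ, v (U (ω, x))| ≤ volume.real Λ * a + b * ∫ x in Λ, |U (ω, x)| := by
      calc |∫ x in Λ, v (U (ω, x))| ≤ ∫ x in Λ, |v (U (ω, x))| := abs_integral_le_integral_abs
        _ ≤ ∫ x in Λ, (a + b * |U (ω, x)|) :=
            integral_mono (integrable_comp_of_linear_growth hv hvab hUΛ).abs
              ((integrable_const a).add (hUΛ.abs.const_mul b)) fun x => hvab _
        _ = _ := by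
            rw [integral_add (integrable_const a) (hUΛ.abs.const_mul b), integral_const_mul]
            simp
    calc t * ∫ x in Λ, v (U (ω, x)) ≤ |t| * |∫ x in Λ, v (U (ω, x))| := by
          rw [← abs_mul]
          exact le_abs_self _
      _ ≤ |t| * (volume.real Λ * a + b * ∫ x in Λ, |U (ω, x)|) := by gcongr
      _ = _ := by ring

variable [IsProbabilityMeasure P]

/-- Moments of the interaction and of the Boltzmann weight, and normalizability of the interacting
law, from exponential moments of the interaction. -/
theorem memLp_boltzmann_and_isProbabilityMeasure {v : ℝ → ℝ} {Λ : Set (Space d)}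
    (h : ∀ t : ℝ, Integrable (fun ω => Real.exp (t * interaction v Λ ω)) P) (β : ℝ) :
    (∀ p : ℝ≥0∞, 1 ≤ p → p ≠ ∞ → MemLp (interaction v Λ) p P) ∧
    (∀ p : ℝ≥0∞, 1 ≤ p → p ≠ ∞ → MemLp (boltzmann v Λ β) p P) ∧
    (0 < partitionFunction v Λ β P ∧ IsProbabilityMeasure (interactingLaw v Λ β P)) := by
  have hset : ProbabilityTheory.integrableExpSet (interaction v Λ) P = Set.univ :=
    Set.eq_univ_of_forall h
  have hpos : 0 < partitionFunction v Λ β P := integral_exp_pos (h (-β))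
  refine ⟨fun p _ hp => ?_, fun p hp1 hp => ?_, hpos, ⟨?_⟩⟩
  · lift p to NNReal using hp
    exact ProbabilityTheory.memLp_of_mem_interior_integrableExpSet (by simp [hset]) p
  · have hp0 : p ≠ 0 := (zero_lt_one.trans_le hp1).ne'
    refine (integrable_norm_rpow_iff (h (-β)).1 hp0 hp).1
      ((h (-β * p.toReal)).congr (ae_of_all _ fun ω => ?_))
    simp only
    rw [Real.norm_of_nonneg (Real.exp_pos _).le, ← Real.exp_mul]
    ring_nf
  · have hb : Integrable (fun ω => boltzmann v Λ β ω / partitionFunction v Λ β P) P :=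
      (h (-β)).div_const _
    rw [interactingLaw, withDensity_apply _ MeasurableSet.univ, Measure.restrict_univ,
      ← ofReal_integral_eq_lintegral_ofReal hb (ae_of_all _ fun ω =>
        div_nonneg (Real.exp_pos _).le hpos.le), integral_div]
    rw [show ∫ ω, boltzmann v Λ β ω ∂P = partitionFunction v Λ β P from rfl, div_self hpos.ne',
      ENNReal.ofReal_one]

lemma IsConvolutedPoissonNoise.congr_ae {z : ℝ} {r : Measure ℝ} {G G' : Space d → ℝ}
    {PX : Measure (Tempered d)} (hX : IsConvolutedPoissonNoise z r G PX)
    (h : G =ᵐ[volume] G') : IsConvolutedPoissonNoise z r G' PX := by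
  obtain ⟨PF, T, hF, hT, rfl⟩ := hX
  exact ⟨PF, T, hF, ⟨hT.aemeasurable, fun f => transposeConv_congr_ae h ▸ hT.pairing f⟩, rfl⟩

/-- Convoluted Poisson noise is given by a jointly measurable function with paths in
`L¹(g_ε dx)` whose local `L¹`-norms have all exponential moments. -/
theorem IsConvolutedPoissonNoise.exists_density {z : ℝ} (hz : 0 ≤ z) {r : Measure ℝ}
    [IsProbabilityMeasure r] {c : ℝ} (hc : 0 ≤ c) (hr : ∀ᵐ s ∂r, |s| ≤ c) {G : Space d → ℝ}
    (hG : Integrable G volume) (hX : IsConvolutedPoissonNoise z r G P) (hε : 0 < ε) :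
    ∃ U : Tempered d × Space d → ℝ, StronglyMeasurable U ∧
      (∀ᵐ ω ∂P, Integrable (fun x => U (ω, x)) (weightedVolume d ε) ∧
        Represents ω fun x => U (ω, x)) ∧
      ∀ Λ : Set (Space d), IsCompact Λ → ∀ α : ℝ, 0 ≤ α →
        ∫⁻ ω, ENNReal.ofReal (Real.exp (α * ∫ x in Λ, |U (ω, x)|)) ∂P < ∞ := by
  have hae := hG.1.ae_eq_mk
  have hGm : Measurable (hG.1.mk G) := hG.1.stronglyMeasurable_mk.measurable
  have hG' : Integrable (hG.1.mk G) volume := hG.congr hae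
  have hchar := (hX.congr_ae hae).charFunctional_eq hGm hG' hz hr
  have hP := lintegral_abs_eval_le hGm hG' hz hc hr hchar
  obtain ⟨U, hU, hUint, hlim⟩ := exists_limit_probeField hε hGm hG' ENNReal.ofReal_ne_top hP
  exact ⟨U, hU, ae_represents hε hGm hG' ENNReal.ofReal_ne_top hP hU hUint hlim,
    fun Λ hΛ α hα =>
      lintegral_exp_setIntegral_lt_top hε hGm hG' hz hc hr hchar hU hUint hlim hΛ hα⟩

end Nonlinear

end CPN

end

theorem theorem3p2
    {d : ℕ} (hd : 1 ≤ d)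
    -- the Poisson noise: activity and compactly supported jump distribution
    {z : ℝ} (hz : 0 ≤ z)
    (r : Measure ℝ) [IsProbabilityMeasure r] (hr0 : r {0} = 0)
    {c : ℝ} (hc : 0 < c) (hr : r (Set.Icc (-c) c)ᶜ = 0)
    -- the integrable kernel and the convoluted Poisson noise
    (G : CPN.Space d → ℝ) (hG : Integrable G volume)
    (PX : Measure (CPN.Tempered d)) [IsProbabilityMeasure PX]
    (hX : CPN.IsConvolutedPoissonNoise z r G PX)
    -- the energy density, the infra-red cut-off and the coupling
    (v : ℝ → ℝ) (hv : Measurable v)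
    {a b : ℝ} (ha : 0 ≤ a) (hb : 0 ≤ b) (hvab : ∀ t, |v t| ≤ a + b * |t|)
    (Λ : Set (CPN.Space d)) (hΛ : IsCompact Λ) {β : ℝ} (hβ : 0 ≤ β) :
    -- (i) `X`, hence `v(X)`, has function paths, and `v(X)` is a random field
    (∀ ε : ℝ, 0 < ε →
      CPN.HasPathsIn PX CPN.coord (CPN.weightedL1 d ε) ∧
      (∀ᵐ ω ∂PX, ∃ u : CPN.Space d → ℝ,
        Integrable u (CPN.weightedVolume d ε) ∧ CPN.Represents ω u ∧
        CPN.nonlinear v ω =ᵐ[volume] (fun x => v (u x)) ∧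
        Integrable (CPN.nonlinear v ω) (CPN.weightedVolume d ε)) ∧
      CPN.IsRandomField PX (CPN.nonlinearField v) ∧
      CPN.HasPathsIn PX (CPN.nonlinearField v) (CPN.weightedL1 d ε)) ∧
    -- (ii)
    (∀ p : ℝ≥0∞, 1 ≤ p → p ≠ ∞ → MemLp (CPN.interaction v Λ) p PX) ∧
    -- (iii)
    (∀ p : ℝ≥0∞, 1 ≤ p → p ≠ ∞ → MemLp (CPN.boltzmann v Λ β) p PX) ∧
    -- (iv)
    (0 < CPN.partitionFunction v Λ β PX ∧
      IsProbabilityMeasure (CPN.interactingLaw v Λ β PX)) := by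
  have hr' : ∀ᵐ s ∂r, |s| ≤ c := by
    rw [ae_iff]
    refine measure_mono_null (fun s hs => ?_) hr
    simpa [← abs_le] using hs
  refine ⟨fun ε hε => ?_, ?_⟩
  · obtain ⟨U, hU, hrep, -⟩ := hX.exists_density hz hc.le hr' hG hε
    have hfin := CPN.isFiniteMeasure_weightedVolume (d := d) hε
    have hX' := CPN.isRandomField_and_hasPathsIn hU (hrep.mono fun ω hω => hω.1)
      (Y := CPN.coord) (hrep.mono fun ω hω f => (hω.2.2 f).2)
    have hvU : ∀ᵐ ω ∂PX, Integrable (fun x => v (U (ω, x))) (CPN.weightedVolume d ε) :=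
      hrep.mono fun ω hω => CPN.integrable_comp_of_linear_growth hv hvab hω.1
    have hvX := CPN.isRandomField_and_hasPathsIn (F := fun q => v (U q))
      (hv.comp hU.measurable).stronglyMeasurable hvU (Y := CPN.nonlinearField v)
      (hrep.mono fun ω hω f => CPN.nonlinearPairing_eq hω.2 _)
    refine ⟨hX'.2, ?_, hvX.1, hvX.2⟩
    filter_upwards [hrep, hvU] with ω hω hvω
    have hae := CPN.nonlinear_ae_eq (v := v) hω.2
    exact ⟨fun x => U (ω, x), hω.1, hω.2, hae,
      hvω.congr (CPN.weightedVolume_absolutelyContinuous.ae_le hae.symm)⟩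
  · -- the weight plays no role in the local statements
    obtain ⟨U, hU, hrep, hexp⟩ := hX.exists_density hz hc.le hr' hG one_pos
    exact CPN.memLp_boltzmann_and_isProbabilityMeasure
      (CPN.integrable_exp_interaction one_pos hU hrep hΛ (hexp Λ hΛ) hv hb hvab) β
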